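/- Let $Y$ be a random compact subset of $\mathbb{R}^2$ such that, for some constants $0<a_1<a_2$, almost surely $D(a_1)\subset Y\subset D(a_2)$, where $D(a)$ is the disk of radius $a$ centred at the origin. Let $\alpha>1$. For $0<r_0<r_1<\infty$, and also for $0<r_0<r_1=\infty$ if $\alpha>3$, let $R$ be a random variable, independent of $Y$, with density proportional to $r^{-\alpha}\mathbf 1(r_0\le r\le r_1)$, and let $M(r_0,r_1)$ be the dead leaves model with grain $X=RY$, that is: $\{(x_i,t_i)\}$ is a homogeneous Poisson point process on $\mathbb{R}^2\times\mathbb{R}$ with intensity one, $(X_i)$ are i.i.d. random closed sets with the law of $X$, independent of $\{(x_i,t_i)\}$, and for every $i$ with $t_i\le 0$ the visible part $V_i$ is $$V_i=(x_i+X_i)\setminus\bigcup_{j:\,t_j\in(t_i,0)}\bigl(x_j+\mathring X_j\bigr),$$ where $\mathring A$ denotes the interior of $A$. For $x\in\mathbb{R}^2$ let $$p(r_0,r_1,x)=\Pr\bigl(\exists\, i:\ t_i\le 0,\ \{0,x\}\subset\mathring V_i\bigr)$$ be the probability that $0$ and $x$ are in the same visible part of $M(r_0,r_1)$. (If the law of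 $Y$ is isotropic, $p(r_0,r_1,x)$ depends on $x$ only through $|x|$; isotropy is not assumed here.) Then for all $x\in\mathbb{R}^2$, $x\neq0$: (i) if $1<\alpha<3$ and the boundary $\partial Y$ almost surely has Lebesgue measure zero, then $\displaystyle\lim_{r_1\to\infty}\ \inf_{0<r_0<r_1}p(r_0,r_1,x)=1$; (ii) if $\alpha>3$, then $\displaystyle\lim_{r_0\to0}\ \sup_{r_0<r_1\le\infty}p(r_0,r_1,x)=0$; (iii) if $\alpha=3$ and the boundary $\partial Y$ almost surely has Lebesgue measure zero, then $\displaystyle\lim_{r_0\to0,\ r_1\to\infty}\ p(r_0,r_1,x)\Bigl(1-2\,\frac{\log r_0}{\log r_1}\Bigr)=1$, where $r_0\to0$ and $r_1\to\infty$ jointly and independently of each other. -/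

import Mathlib

open MeasureTheory ProbabilityTheory TopologicalSpace Set Filter Topology
open scoped Pointwise

universe u

/-- The Euclidean plane. -/
abbrev Plane : Type := EuclideanSpace ℝ (Fin 2)

/-- The Borel σ-algebra of the hit-or-miss (Fell) topology on the closed subsets of the plane,
given through its usual generators `{F | F ∩ K = ∅}`, `K` compact. -/
instance Plane.measurableSpaceCloseds : MeasurableSpace (Closeds Plane) :=
  MeasurableSpace.generateFrom
    {A | ∃ K : Set Plane, IsCompact K ∧ A = {F : Closeds Plane | (F : Set Plane) ∩ K = ∅}}

/-- The homothetic image `r F = {r y | y ∈ F}` of a closed set. -/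
def scaleCloseds (r : ℝ) (F : Closeds Plane) : Closeds Plane :=
  ⟨r • (F : Set Plane), F.isClosed.smul₀ r⟩

/-- The interval `[r₀, r₁]` of real numbers; `r₁ = ⊤` is allowed and gives `[r₀, ∞)`. -/
def radiusRange (r₀ : ℝ) (r₁ : EReal) : Set ℝ :=
  {r | r₀ ≤ r ∧ (r : EReal) ≤ r₁}

/-- The probability density proportional to `r ↦ r ^ (-α)` on `[r₀, r₁]`, and zero elsewhere. -/
noncomputable def radiusDensity (α r₀ : ℝ) (r₁ : EReal) (r : ℝ) : ℝ :=
  (∫ s in radiusRange r₀ r₁, s ^ (-α))⁻¹ * (radiusRange r₀ r₁).indicator (fun s => s ^ (-α)) r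

/-- The law of the random scaling factor `R`. -/
noncomputable def radiusLaw (α r₀ : ℝ) (r₁ : EReal) : Measure ℝ :=
  volume.withDensity fun r => ENNReal.ofReal (radiusDensity α r₀ r₁ r)

/-- The law of the grain `X = R Y`, where `R` has law `radiusLaw α r₀ r₁`, the random closed
set `Y` has law `lawY`, and `R` and `Y` are independent. -/
noncomputable def grainLaw (α r₀ : ℝ) (r₁ : EReal) (lawY : Measure (Closeds Plane)) :
    Measure (Closeds Plane) :=
  ((radiusLaw α r₀ r₁).prod lawY).map fun q => scaleCloseds q.1 q.2

/-- The random points `(Z i)` form a Poisson point process with intensity measure `Λ`: the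
numbers of points in pairwise disjoint measurable sets of finite intensity are independent
Poisson variables with parameters `Λ (A j)`. -/
structure IsPoissonProcess {Ω S : Type*} [MeasurableSpace Ω] [MeasurableSpace S]
    (P : Measure Ω) (Z : ℕ → Ω → S) (Λ : Measure S) : Prop where
  measurable_point : ∀ i, Measurable (Z i)
  count_law : ∀ (n : ℕ) (A : Fin n → Set S), (∀ j, MeasurableSet (A j)) →
    (∀ j, Λ (A j) < ⊤) → Pairwise (fun j k => Disjoint (A j) (A k)) → ∀ m : Fin n → ℕ,
    P {ω | ∀ j, {i | Z i ω ∈ A j}.encard = m j} =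
      ∏ j, poissonMeasure (Λ (A j)).toNNReal {m j}

/-- A random sequence of leaves on a probability space: leaf `i` falls at time `time i`, at
position `pos i`, and has the shape `grain i`. -/
structure LeafSequence where
  Ω : Type u
  [measurableSpace : MeasurableSpace Ω]
  P : Measure Ω
  [isProbabilityMeasure : IsProbabilityMeasure P]
  pos : ℕ → Ω → Plane
  time : ℕ → Ω → ℝ
  grain : ℕ → Ω → Closeds Plane

namespace LeafSequence

attribute [instance] measurableSpace isProbabilityMeasure

/-- The leaves are those of the dead leaves model whose grain has law `μ`: the points
`(pos i, time i)` form a Poisson point process on the product of the plane and the line with the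
Lebesgue measure as its intensity, and the grains are independent random closed sets of law `μ`,
independent of these points. -/
structure IsDeadLeaves (M : LeafSequence.{u}) (μ : Measure (Closeds Plane)) : Prop where
  poisson : IsPoissonProcess M.P (fun i ω => (M.pos i ω, M.time i ω))
    (volume : Measure (Plane × ℝ))
  measurable_grain : ∀ i, Measurable (M.grain i)
  grain_law : ∀ i, M.P.map (M.grain i) = μ
  grain_indep : iIndepFun M.grain M.P
  grain_indep_points : IndepFun (fun ω i => M.grain i ω)
    (fun ω i => (M.pos i ω, M.time i ω)) M.P

/-- The visible part `V i`: the points of leaf `i` that are not in the interior of a leaf that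
falls after it and before time `0`. -/
def visiblePart (M : LeafSequence.{u}) (i : ℕ) (ω : M.Ω) : Set Plane :=
  (M.pos i ω +ᵥ (M.grain i ω : Set Plane)) \
    ⋃ j ∈ {j | M.time j ω ∈ Ioo (M.time i ω) 0},
      (M.pos j ω +ᵥ interior (M.grain j ω : Set Plane))

/-- The probability that a set `K` is included in (the interior of) a visible part of the model,
the leaves being those that fall up to time `0`. -/
noncomputable def inclusionProb (M : LeafSequence.{u}) (K : Set Plane) : ℝ :=
  M.P.real {ω | ∃ i, M.time i ω ≤ 0 ∧ K ⊆ interior (M.visiblePart i ω)}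

/-- The probability that the origin and `x` are in the same visible part of the model. -/
noncomputable def sameVisibleProb (M : LeafSequence.{u}) (x : Plane) : ℝ :=
  M.inclusionProb {0, x}

end LeafSequence

/-!
The points `0` and `x` are in the same visible part when the last leaf before time `0` that hits
one of them contains both. So `p(r₀, r₁, x)` is the probability that the last leaf hitting `{0, x}`
contains both points, and this is the ratio of two intensities: that of the leaves containing both
points and that of the leaves hitting at least one of them.

The ratio comes from void probabilities alone. A Poisson process with independent marks has the
void probabilities `exp (-(Λ ⊗ μ) A)` (`IsPoissonProcess.measure_marked_void`), by the Laplace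
functional of the process (`IsPoissonProcess.lintegral_iInf_prod_one_sub`). Cutting time into slabs
of length `δ` and looking for the slab of the last hit gives upper and lower bounds by geometric
series, whose sums tend to the ratio as `δ` tends to `0` (`lastHitEvent_mul_le`,
`le_lastHitEvent_mul`). The upper bound takes "hit" in the sense of interiors; the lower bound takes
it in the sense of closed grains, and needs bounded grains to have locally finitely many leaves
(`lastHitEvent_le`). The two notions agree when the boundary of `Y` is a null set.

By homothety both intensities become integrals over the scaling factor: with `V` the mean area of
the interior of `Y` and `φ r` the mean area of its intersection with its translate by `-x / r`, they
are proportional to `∫ r ^ (2 - α) * φ r` and, by inclusion and exclusion,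
`∫ r ^ (2 - α) * (2 * V - φ r)`. Here `0 ≤ φ ≤ V`, `φ` vanishes near `0` since `Y` is bounded, and
`φ r` tends to `V` as `r` tends to infinity. For `α < 3` the large radii dominate both integrals,
where the integrands are almost equal. For `α > 3` the small radii dominate the second integral
only. For `α = 3` the first integral is equivalent to `V * log r₁` and the second one is
`2 * V * (log r₁ - log r₀)` minus the first.
-/

/-! ### Void probabilities of Poisson processes -/

/-- The probability generating function of a Poisson law, at the point `1 - a` of `[0, 1]`. -/
lemma lintegral_one_sub_pow_poissonMeasure (r : NNReal) {a : ENNReal} (ha : a ≤ 1) :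
    ∫⁻ k, (1 - a) ^ k ∂(poissonMeasure r) = ENNReal.ofReal (Real.exp (-(a.toReal * r))) := by
  lift a to NNReal using ne_top_of_le_ne_top ENNReal.one_ne_top ha
  have ha' : (a : ℝ) ≤ 1 := by exact_mod_cast ha
  have h1 : (1 - (a : ENNReal)) = ENNReal.ofReal (1 - a) := by
    rw [ENNReal.ofReal_sub _ a.coe_nonneg, ENNReal.ofReal_one, ENNReal.ofReal_coe_nnreal]
  rw [lintegral_countable']
  have h2 : ∀ k : ℕ, (1 - (a : ENNReal)) ^ k * poissonMeasure r {k} =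
      ENNReal.ofReal (Real.exp (-r) * (((1 - a) * r) ^ k / k.factorial)) := by
    intro k
    rw [poissonMeasure_singleton, h1, ← ENNReal.ofReal_pow (by linarith),
      ← ENNReal.ofReal_mul (by have : (0 : ℝ) ≤ 1 - a := by linarith
                               positivity)]
    congr 1
    rw [mul_pow]; ring
  simp_rw [h2]
  have h3 := (NormedSpace.expSeries_div_hasSum_exp ((1 - (a : ℝ)) * r)).mul_left (Real.exp (-r))
  rw [← Real.exp_eq_exp_ℝ, ← Real.exp_add] at h3
  have h0 : (0 : ℝ) ≤ (1 - a) * r := mul_nonneg (by linarith) r.2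
  rw [← ENNReal.ofReal_tsum_of_nonneg (fun k => by positivity) h3.summable, h3.tsum_eq]
  congr 2
  simp only [ENNReal.coe_toReal]
  ring

lemma measurableSet_encard_setOf_eq {Ω S : Type*} [MeasurableSpace Ω] [MeasurableSpace S]
    {Z : ℕ → Ω → S} (hZ : ∀ i, Measurable (Z i)) {A : Set S} (hA : MeasurableSet A) (m : ℕ) :
    MeasurableSet {ω | {i | Z i ω ∈ A}.encard = m} := by
  have key : ∀ k : ℕ, MeasurableSet {ω | (k : ℕ∞) ≤ {i | Z i ω ∈ A}.encard} := by
    intro k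
    have : {ω | (k : ℕ∞) ≤ {i | Z i ω ∈ A}.encard} =
        ⋃ T : {T : Finset ℕ // T.card = k}, ⋂ i ∈ T.1, Z i ⁻¹' A := by
      ext ω
      simp only [mem_ofPred_eq, mem_iUnion, mem_iInter, mem_preimage, Subtype.exists, exists_prop]
      constructor
      · intro h
        obtain ⟨t, ht, htk⟩ := Set.exists_subset_encard_eq h
        have hf : t.Finite := Set.finite_of_encard_eq_coe htk
        refine ⟨hf.toFinset, ?_, fun i hi => ht (by simpa using hi)⟩
        rw [hf.encard_eq_coe_toFinset_card] at htk
        exact_mod_cast htk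
      · rintro ⟨T, hT, h⟩
        rw [← hT, ← Set.encard_coe_eq_coe_finsetCard]
        exact Set.encard_le_encard fun i hi => h i (by simpa using hi)
    rw [this]
    exact MeasurableSet.iUnion fun T => Finset.measurableSet_biInter _ fun i _ => hZ i hA
  have : {ω | {i | Z i ω ∈ A}.encard = m} =
      {ω | (m : ℕ∞) ≤ {i | Z i ω ∈ A}.encard} \ {ω | ((m + 1 : ℕ) : ℕ∞) ≤ {i | Z i ω ∈ A}.encard} := by
    ext ω
    simp only [mem_ofPred_eq, Set.mem_sdiff, not_le, Nat.cast_add, Nat.cast_one]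
    rw [ENat.lt_add_one_iff (ENat.natCast_ne_top m), le_antisymm_iff, and_comm]
  rw [this]
  exact (key m).diff (key (m + 1))

namespace IsPoissonProcess

variable {Ω S : Type*} [MeasurableSpace Ω] [MeasurableSpace S] {P : Measure Ω} {Z : ℕ → Ω → S}
  {Λ : Measure S}

lemma count_law_fintype (hZ : IsPoissonProcess P Z Λ) {ι : Type*} [Fintype ι] (A : ι → Set S)
    (hA : ∀ j, MeasurableSet (A j)) (hΛ : ∀ j, Λ (A j) < ⊤)
    (hd : Pairwise fun j k => Disjoint (A j) (A k)) (m : ι → ℕ) :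
    P {ω | ∀ j, {i | Z i ω ∈ A j}.encard = m j} =
      Measure.pi (fun j => poissonMeasure (Λ (A j)).toNNReal) {m} := by
  let e := Fintype.equivFin ι
  have h := hZ.count_law _ (fun j => A (e.symm j)) (fun j => hA _) (fun j => hΛ _)
    (fun j k hjk => hd (e.symm.injective.ne hjk)) (fun j => m (e.symm j))
  rw [Measure.pi_singleton, ← e.symm.prod_comp, ← h]
  congr 1
  ext ω
  simp only [mem_ofPred_eq]
  exact ⟨fun h j => h _, fun h j => by simpa using h (e j)⟩

/-- A variable that is a product of powers of the counts of disjoint sets `A j` has the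
expectation given by independent Poisson counts. -/
lemma lintegral_eq_prod_of_count [IsProbabilityMeasure P] (hZ : IsPoissonProcess P Z Λ)
    {ι : Type*} [Fintype ι] (A : ι → Set S)
    (hA : ∀ j, MeasurableSet (A j)) (hΛ : ∀ j, Λ (A j) < ⊤)
    (hd : Pairwise fun j k => Disjoint (A j) (A k)) (c : ι → ENNReal) (hc : ∀ j, c j ≤ 1)
    (W : Ω → ENNReal) (hW : ∀ (m : ι → ℕ) (ω : Ω), (∀ j, {i | Z i ω ∈ A j}.encard = m j) →
      W ω = ∏ j, (1 - c j) ^ m j) :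
    ∫⁻ ω, W ω ∂P = ∏ j, ENNReal.ofReal (Real.exp (-((c j).toReal * (Λ (A j)).toReal))) := by
  -- almost surely exactly one of the events `E m` occurs, and their probabilities are those of
  -- the points `m` under a product of Poisson laws
  set E : (ι → ℕ) → Set Ω := fun m => {ω | ∀ j, {i | Z i ω ∈ A j}.encard = m j}
  have hE : ∀ m, MeasurableSet (E m) := fun m => by
    have : E m = ⋂ j, {ω | {i | Z i ω ∈ A j}.encard = m j} := by ext; simp [E]
    rw [this]
    exact MeasurableSet.iInter fun j => measurableSet_encard_setOf_eq hZ.measurable_point (hA j) _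
  have hEd : Pairwise (Function.onFun Disjoint E) := by
    intro m m' hne
    refine Set.disjoint_left.2 fun ω h h' => hne (funext fun j => ?_)
    exact_mod_cast (h j).symm.trans (h' j)
  set ν := Measure.pi (fun j => poissonMeasure (Λ (A j)).toNNReal)
  have hP : ∀ m, P (E m) = ν {m} := hZ.count_law_fintype A hA hΛ hd
  have hfull : P (⋃ m, E m) = 1 := by
    rw [measure_iUnion hEd hE]
    simp_rw [hP]
    have := lintegral_countable' (μ := ν) (fun _ => (1 : ENNReal))
    simpa using this.symm
  have hae : (⋃ m, E m) =ᵐ[P] (univ : Set Ω) := by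
    rw [ae_eq_univ, prob_compl_eq_zero_iff (MeasurableSet.iUnion hE)]
    exact hfull
  rw [← setLIntegral_univ, ← setLIntegral_congr hae, lintegral_iUnion hE hEd]
  have h1 : ∀ m, ∫⁻ ω in E m, W ω ∂P = (∏ j, (1 - c j) ^ m j) * ν {m} := by
    intro m
    rw [setLIntegral_congr_fun (hE m) (fun ω hω => hW m ω hω), setLIntegral_const, hP]
  simp_rw [h1]
  rw [← lintegral_countable' (μ := ν) (fun m => ∏ j, (1 - c j) ^ m j)]
  have hind : iIndepFun (fun (j : ι) (m : ι → ℕ) => (1 - c j) ^ m j) ν :=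
    iIndepFun_pi (X := fun j k => (1 - c j) ^ k)
      (fun j => (measurable_of_countable _).aemeasurable)
  have h2 := lintegral_prod_eq_prod_lintegral_of_indepFun Finset.univ _ hind
    (fun j => measurable_of_countable _)
  rw [h2]
  refine Finset.prod_congr rfl fun j _ => ?_
  have h3 := (measurePreserving_eval (fun j => poissonMeasure (Λ (A j)).toNNReal) j).lintegral_comp
    (f := fun k => (1 - c j) ^ k) (measurable_of_countable _)
  simp only [Function.eval] at h3
  rw [h3, lintegral_one_sub_pow_poissonMeasure _ (hc j)]
  rfl

/-- The Laplace functional of a Poisson process on simple functions. -/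
lemma lintegral_iInf_prod_one_sub_simpleFunc [IsProbabilityMeasure P]
    (hZ : IsPoissonProcess P Z Λ) (φ : SimpleFunc S ENNReal) (hφ : ∀ z, φ z ≤ 1)
    (hfin : ∫⁻ z, φ z ∂Λ ≠ ⊤) :
    ∫⁻ ω, ⨅ n : ℕ, ∏ i ∈ Finset.range n, (1 - φ (Z i ω)) ∂P =
      ENNReal.ofReal (Real.exp (-(∫⁻ z, φ z ∂Λ).toReal)) := by
  classical
  let ι := {c // c ∈ φ.range.erase 0}
  have hsum : ∫⁻ z, φ z ∂Λ = ∑ c : ι, c.1 * Λ (φ ⁻¹' {c.1}) := by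
    rw [SimpleFunc.lintegral_eq_lintegral, SimpleFunc.lintegral,
      Finset.sum_coe_sort (φ.range.erase 0) (fun c => c * Λ (φ ⁻¹' {c}))]
    exact (Finset.sum_erase _ (by simp)).symm
  have hfin' : ∀ c : ι, c.1 * Λ (φ ⁻¹' {c.1}) ≠ ⊤ := by
    rw [hsum] at hfin
    exact fun c => (ENNReal.sum_ne_top.1 hfin) c (Finset.mem_univ _)
  have hc0 : ∀ c : ι, c.1 ≠ 0 := fun c => Finset.ne_of_mem_erase c.2
  have hc1 : ∀ c : ι, c.1 ≤ 1 := fun c => by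
    obtain ⟨z, hz⟩ := SimpleFunc.mem_range.1 (Finset.mem_of_mem_erase c.2)
    rw [← hz]; exact hφ z
  have hΛ : ∀ c : ι, Λ (φ ⁻¹' {c.1}) < ⊤ := fun c => by
    rw [lt_top_iff_ne_top]
    intro h
    exact hfin' c (by rw [h, ENNReal.mul_top (hc0 c)])
  rw [hZ.lintegral_eq_prod_of_count (fun c : ι => φ ⁻¹' {c.1}) (fun c => φ.measurableSet_fiber _) hΛ
    (fun c d hcd => Disjoint.preimage _ (by simpa using fun h => hcd (Subtype.ext h)))
    (fun c => c.1) hc1]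
  · rw [hsum, ENNReal.toReal_sum (fun c _ => hfin' c), ← Finset.sum_neg_distrib, Real.exp_sum,
      ENNReal.ofReal_prod_of_nonneg (fun _ _ => (Real.exp_pos _).le)]
    simp [ENNReal.toReal_mul]
  · intro m ω hm
    have hf : ∀ c : ι, {i | Z i ω ∈ φ ⁻¹' {c.1}}.Finite := fun c =>
      Set.finite_of_encard_eq_coe (hm c)
    have hprod : ∀ n : ℕ, ∏ i ∈ Finset.range n, (1 - φ (Z i ω)) =
        ∏ c : ι, (1 - c.1) ^ ((Finset.range n).filter (fun i => φ (Z i ω) = c.1)).card := by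
      intro n
      have h1 : ∀ i, 1 - φ (Z i ω) = ∏ c : ι, if φ (Z i ω) = c.1 then 1 - c.1 else 1 := by
        intro i
        by_cases h0 : φ (Z i ω) = 0
        · rw [h0, Finset.prod_congr rfl (g := fun _ => 1)]
          · simp
          · intro c _
            rw [if_neg (hc0 c).symm]
        · let c₀ : ι := ⟨φ (Z i ω), Finset.mem_erase.2 ⟨h0, SimpleFunc.mem_range_self _ _⟩⟩
          rw [Finset.prod_eq_single c₀]
          · simp [c₀]
          · intro c _ hc
            rw [if_neg]
            intro h
            exact hc (Subtype.ext h.symm)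
          · simp
      simp_rw [h1]
      rw [Finset.prod_comm]
      refine Finset.prod_congr rfl fun c _ => ?_
      rw [Finset.prod_ite, Finset.prod_const, Finset.prod_const_one, mul_one]
    have hanti : Antitone fun n : ℕ => ∏ i ∈ Finset.range n, (1 - φ (Z i ω)) :=
      antitone_nat_of_succ_le fun n => by
        rw [Finset.prod_range_succ]
        exact mul_le_of_le_one_right' tsub_le_self
    refine tendsto_nhds_unique (tendsto_atTop_iInf hanti) ?_
    refine tendsto_const_nhds.congr' ?_
    -- the product is constant once it ranges over all the points where `φ` is nonzero
    have : ∀ᶠ n in atTop, ∀ c : ι, (hf c).toFinset ⊆ Finset.range n := by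
      rw [eventually_all]
      intro c
      obtain ⟨N, hN⟩ := (hf c).toFinset.exists_nat_subset_range
      filter_upwards [eventually_ge_atTop N] with n hn
      exact hN.trans (Finset.range_mono hn)
    filter_upwards [this] with n hn
    rw [hprod]
    refine Finset.prod_congr rfl fun c _ => ?_
    have h2 : (Finset.range n).filter (fun i => φ (Z i ω) = c.1) = (hf c).toFinset := by
      ext i
      simp only [Finset.mem_filter, Set.Finite.mem_toFinset, mem_ofPred_eq, mem_preimage,
        mem_singleton_iff, and_iff_right_iff_imp]
      intro hi
      exact hn c (by simpa using hi)
    have h3 := hm c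
    rw [(hf c).encard_eq_coe_toFinset_card] at h3
    rw [h2]
    congr 1
    exact_mod_cast h3.symm

/-- The Laplace functional of a Poisson process: the expectation of the infinite product of the
factors `1 - h (Z i)` is `exp (-∫ h ∂Λ)`. -/
lemma lintegral_iInf_prod_one_sub [IsProbabilityMeasure P]
    (hZ : IsPoissonProcess P Z Λ) {h : S → ENNReal} (hm : Measurable h) (h1 : ∀ z, h z ≤ 1)
    (hfin : ∫⁻ z, h z ∂Λ ≠ ⊤) :
    ∫⁻ ω, ⨅ n : ℕ, ∏ i ∈ Finset.range n, (1 - h (Z i ω)) ∂P =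
      ENNReal.ofReal (Real.exp (-(∫⁻ z, h z ∂Λ).toReal)) := by
  set φ := SimpleFunc.eapprox h
  have hle : ∀ k z, φ k z ≤ h z := fun k z => by
    rw [← SimpleFunc.iSup_eapprox_apply hm z]
    exact le_iSup (fun k => φ k z) k
  have hmeas : ∀ k, Measurable fun ω => ⨅ n : ℕ, ∏ i ∈ Finset.range n, (1 - φ k (Z i ω)) :=
    fun k => Measurable.iInf fun n => Finset.measurable_prod _ fun i _ =>
      measurable_const.sub ((φ k).measurable.comp (hZ.measurable_point i))
  have hLHS : ∀ ω, ⨅ n : ℕ, ∏ i ∈ Finset.range n, (1 - h (Z i ω)) =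
      ⨅ k : ℕ, ⨅ n : ℕ, ∏ i ∈ Finset.range n, (1 - φ k (Z i ω)) := by
    intro ω
    rw [iInf_comm]
    refine iInf_congr fun n => ?_
    have hanti : Antitone fun k => ∏ i ∈ Finset.range n, (1 - φ k (Z i ω)) := fun k l hkl =>
      Finset.prod_le_prod' fun i _ => tsub_le_tsub_left (SimpleFunc.monotone_eapprox h hkl _) 1
    refine tendsto_nhds_unique ?_ (tendsto_atTop_iInf hanti)
    refine ENNReal.tendsto_finsetProd_of_ne_top _ (fun i _ => ?_) (fun i _ => ?_)
    · exact ENNReal.Tendsto.sub tendsto_const_nhds (SimpleFunc.tendsto_eapprox hm _)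
        (Or.inl ENNReal.one_ne_top)
    · exact ne_top_of_le_ne_top ENNReal.one_ne_top tsub_le_self
  simp_rw [hLHS]
  rw [lintegral_iInf hmeas]
  · have hfin' : ∀ k, ∫⁻ z, φ k z ∂Λ ≠ ⊤ := fun k =>
      ne_top_of_le_ne_top hfin (lintegral_mono (hle k))
    simp_rw [fun k => hZ.lintegral_iInf_prod_one_sub_simpleFunc (φ k)
      (fun z => (hle k z).trans (h1 z)) (hfin' k)]
    have hmono : Monotone fun k => ∫⁻ z, φ k z ∂Λ := fun k l hkl =>
      lintegral_mono (SimpleFunc.monotone_eapprox h hkl)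
    have hlim : Tendsto (fun k => ∫⁻ z, φ k z ∂Λ) atTop (𝓝 (∫⁻ z, h z ∂Λ)) := by
      have := lintegral_iSup (μ := Λ) (fun k => (φ k).measurable)
        (SimpleFunc.monotone_eapprox h)
      simp_rw [φ, SimpleFunc.iSup_eapprox_apply hm] at this
      rw [this]
      exact tendsto_atTop_iSup hmono
    refine tendsto_nhds_unique (tendsto_atTop_iInf ?_) ?_
    · intro k l hkl
      have := ENNReal.toReal_mono (hfin' l) (hmono hkl)
      dsimp only
      gcongr
    · refine (ENNReal.continuous_ofReal.tendsto _).comp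
        ((Real.continuous_exp.tendsto _).comp (Tendsto.neg ?_))
      exact (ENNReal.tendsto_toReal hfin).comp hlim
  · intro k l hkl ω
    exact iInf_mono fun n => Finset.prod_le_prod' fun i _ =>
      tsub_le_tsub_left (SimpleFunc.monotone_eapprox h hkl _) 1
  · refine ne_top_of_le_ne_top ENNReal.one_ne_top ?_
    refine (lintegral_mono (g := fun _ => 1) fun ω => ?_).trans (by simp)
    exact (iInf_le _ 0).trans (by simp)

/-- The void probability of a Poisson process whose points carry independent marks of law `μ`. -/
lemma measure_marked_void [IsProbabilityMeasure P] {T : Type*} [MeasurableSpace T]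
    (hZ : IsPoissonProcess P Z Λ) [SFinite Λ] {μ : Measure T} [IsProbabilityMeasure μ]
    {X : ℕ → Ω → T} (hX : ∀ i, Measurable (X i)) (hXμ : ∀ i, P.map (X i) = μ)
    (hXi : iIndepFun X P) (hXZ : IndepFun (fun ω i => X i ω) (fun ω i => Z i ω) P)
    {A : Set (S × T)} (hA : MeasurableSet A) (hfin : (Λ.prod μ) A ≠ ⊤) :
    P {ω | ∀ i, (Z i ω, X i ω) ∉ A} = ENNReal.ofReal (Real.exp (-((Λ.prod μ) A).toReal)) := by
  set h : S → ENNReal := fun z => μ (Prod.mk z ⁻¹' A)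
  have hm : Measurable h := measurable_measure_prodMk_left hA
  have hint : ∫⁻ z, h z ∂Λ = (Λ.prod μ) A := (Measure.prod_apply hA).symm
  have hZm := hZ.measurable_point
  -- given the points, the marks of the first `n` points are independent of law `μ`
  have hn : ∀ n : ℕ, P {ω | ∀ i < n, (Z i ω, X i ω) ∉ A} =
      ∫⁻ ω, ∏ i ∈ Finset.range n, (1 - h (Z i ω)) ∂P := by
    intro n
    let X' : Ω → (Fin n → T) := fun ω i => X i ω
    let Z' : Ω → (Fin n → S) := fun ω i => Z i ω
    have hX' : Measurable X' := measurable_pi_lambda _ fun i => hX i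
    have hZ' : Measurable Z' := measurable_pi_lambda _ fun i => hZm i
    have hind : IndepFun Z' X' P := by
      refine IndepFun.symm (hXZ.comp (φ := fun (f : ℕ → T) (i : Fin n) => f i)
        (ψ := fun (f : ℕ → S) (i : Fin n) => f i) ?_ ?_) <;>
      exact measurable_pi_lambda _ fun i => measurable_pi_apply _
    have hlaw : P.map X' = Measure.pi fun _ : Fin n => μ := by
      have h2 : iIndepFun (fun i : Fin n => X i) P := hXi.precomp Fin.val_injective
      have h3 := (iIndepFun_iff_map_fun_eq_pi_map (fun i : Fin n => (hX i).aemeasurable)).1 h2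
      simpa [hXμ] using h3
    have hB : MeasurableSet {q : (Fin n → S) × (Fin n → T) | ∀ i, (q.1 i, q.2 i) ∉ A} := by
      have : {q : (Fin n → S) × (Fin n → T) | ∀ i, (q.1 i, q.2 i) ∉ A} =
          ⋂ i, (fun q : (Fin n → S) × (Fin n → T) => (q.1 i, q.2 i)) ⁻¹' Aᶜ := by
        ext; simp
      rw [this]
      refine MeasurableSet.iInter fun i => ?_
      exact (((measurable_pi_apply i).comp measurable_fst).prodMk
        ((measurable_pi_apply i).comp measurable_snd)) hA.compl
    have e1 : {ω | ∀ i < n, (Z i ω, X i ω) ∉ A} = (fun ω => (Z' ω, X' ω)) ⁻¹'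
        {q : (Fin n → S) × (Fin n → T) | ∀ i, (q.1 i, q.2 i) ∉ A} := by
      ext ω
      simp only [mem_ofPred_eq, mem_preimage, Z', X']
      exact ⟨fun h i => h i i.2, fun h i hi => h ⟨i, hi⟩⟩
    rw [e1, ← Measure.map_apply (hZ'.prodMk hX') hB,
      (indepFun_iff_map_prod_eq_prod_map_map hZ'.aemeasurable hX'.aemeasurable).1 hind, hlaw,
      Measure.prod_apply hB, lintegral_map (measurable_measure_prodMk_left hB) hZ']
    refine lintegral_congr fun ω => ?_
    have e2 : Prod.mk (Z' ω) ⁻¹' {q : (Fin n → S) × (Fin n → T) | ∀ i, (q.1 i, q.2 i) ∉ A} =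
        Set.pi univ fun i : Fin n => (Prod.mk (Z i ω) ⁻¹' A)ᶜ := by
      ext f
      simp [Z']
    rw [e2, Measure.pi_pi, ← Fin.prod_univ_eq_prod_range (fun i => 1 - h (Z i ω)) n]
    refine Finset.prod_congr rfl fun i _ => ?_
    exact prob_compl_eq_one_sub (measurable_prodMk_left hA)
  have hfm : ∀ n, Measurable fun ω => ∏ i ∈ Finset.range n, (1 - h (Z i ω)) := fun n =>
    Finset.measurable_prod _ fun i _ => measurable_const.sub (hm.comp (hZm i))
  rw [← hint, ← hZ.lintegral_iInf_prod_one_sub hm (fun z => prob_le_one) (by rwa [hint]),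
    lintegral_iInf hfm]
  · simp_rw [← hn]
    have e3 : {ω | ∀ i, (Z i ω, X i ω) ∉ A} = ⋂ n : ℕ, {ω | ∀ i < n, (Z i ω, X i ω) ∉ A} := by
      ext ω
      simp only [mem_ofPred_eq, mem_iInter]
      exact ⟨fun h n i _ => h i, fun h i => h (i + 1) i (Nat.lt_succ_self i)⟩
    rw [e3]
    refine Antitone.measure_iInter (fun n k hnk ω hω i hi => hω i (hi.trans_le hnk)) (fun n => ?_)
      ⟨0, measure_ne_top _ _⟩
    have : {ω | ∀ i < n, (Z i ω, X i ω) ∉ A} =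
        ⋂ i ∈ Finset.range n, (fun ω => (Z i ω, X i ω)) ⁻¹' Aᶜ := by
      ext ω; simp
    rw [this]
    exact (Finset.measurableSet_biInter _ fun i _ =>
      ((hZm i).prodMk (hX i)) hA.compl).nullMeasurableSet
  · exact antitone_nat_of_succ_le fun n ω => by
      dsimp only
      rw [Finset.prod_range_succ]
      exact mul_le_of_le_one_right' tsub_le_self
  · simp

/-- Almost surely, only finitely many points fall in a set of finite intensity. -/
lemma ae_finite [IsProbabilityMeasure P] (hZ : IsPoissonProcess P Z Λ) {A : Set S}
    (hA : MeasurableSet A) (hΛ : Λ A < ⊤) : ∀ᵐ ω ∂P, {i | Z i ω ∈ A}.Finite := by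
  have h := hZ.lintegral_eq_prod_of_count (ι := Unit) (fun _ => A) (fun _ => hA) (fun _ => hΛ)
    (fun i j hij => (hij rfl).elim) (fun _ => 0) (fun _ => zero_le)
    (Set.indicator {ω | {i | Z i ω ∈ A}.Finite} 1) (fun m ω hm => by
      simp [Set.indicator, Set.finite_of_encard_eq_coe (hm ())])
  have hmeas : MeasurableSet {ω | {i | Z i ω ∈ A}.Finite} := by
    have : {ω | {i | Z i ω ∈ A}.Finite} = ⋃ m : ℕ, {ω | {i | Z i ω ∈ A}.encard = m} := by
      ext ω
      simp only [mem_ofPred_eq, mem_iUnion]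
      exact ⟨fun h => ⟨_, h.encard_eq_coe_toFinset_card⟩,
        fun ⟨m, hm⟩ => Set.finite_of_encard_eq_coe hm⟩
    rw [this]
    exact MeasurableSet.iUnion fun m => measurableSet_encard_setOf_eq hZ.measurable_point hA m
  rw [lintegral_indicator_one hmeas] at h
  exact (mem_ae_iff_prob_eq_one hmeas).2 (by simpa using h)

end IsPoissonProcess

/-! ### The last leaf that hits -/

namespace LeafSequence

/-- Leaf `i` seen from the origin: the position of the origin relative to the leaf, together with
the shape of the leaf. -/
def mark (M : LeafSequence.{u}) (i : ℕ) (ω : M.Ω) : Plane × Closeds Plane :=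
  (-M.pos i ω, M.grain i ω)

/-- No leaf has its time and its mark in `B`. -/
def voidEvent (M : LeafSequence.{u}) (B : Set (ℝ × (Plane × Closeds Plane))) : Set M.Ω :=
  {ω | ∀ i, (M.time i ω, M.mark i ω) ∉ B}

/-- Some leaf that fell up to time `0` has its mark in `C`, and no leaf that fell strictly between
this leaf and time `0` has its mark in `H`. -/
def lastHitEvent (M : LeafSequence.{u}) (C H : Set (Plane × Closeds Plane)) : Set M.Ω :=
  {ω | ∃ i, M.time i ω ≤ 0 ∧ M.mark i ω ∈ C ∧
    ∀ j, M.time j ω ∈ Ioo (M.time i ω) 0 → M.mark j ω ∉ H}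

namespace IsDeadLeaves

variable {M : LeafSequence.{u}} {μ : Measure (Closeds Plane)}

lemma isProbabilityMeasure (hM : M.IsDeadLeaves μ) : IsProbabilityMeasure μ :=
  hM.grain_law 0 ▸ Measure.isProbabilityMeasure_map (hM.measurable_grain 0).aemeasurable

lemma measurable_time (hM : M.IsDeadLeaves μ) (i : ℕ) : Measurable (M.time i) :=
  (hM.poisson.measurable_point i).snd

lemma measurable_mark (hM : M.IsDeadLeaves μ) (i : ℕ) : Measurable (M.mark i) :=
  (hM.poisson.measurable_point i).fst.neg.prodMk (hM.measurable_grain i)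

lemma measurableSet_voidEvent (hM : M.IsDeadLeaves μ) {B : Set (ℝ × (Plane × Closeds Plane))}
    (hB : MeasurableSet B) : MeasurableSet (M.voidEvent B) := by
  have : M.voidEvent B = ⋂ i, (fun ω => (M.time i ω, M.mark i ω)) ⁻¹' Bᶜ := by
    ext; simp [voidEvent]
  rw [this]
  exact MeasurableSet.iInter fun i => ((hM.measurable_time i).prodMk (hM.measurable_mark i)) hB.compl

/-- Times and marks form a Poisson process, so its void probabilities are exponential. -/
lemma measureReal_voidEvent (hM : M.IsDeadLeaves μ) {B : Set (ℝ × (Plane × Closeds Plane))}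
    (hB : MeasurableSet B)
    (hfin : ((volume : Measure ℝ).prod ((volume : Measure Plane).prod μ)) B ≠ ⊤) :
    M.P.real (M.voidEvent B) =
      Real.exp (-((volume : Measure ℝ).prod ((volume : Measure Plane).prod μ)).real B) := by
  have := hM.isProbabilityMeasure
  have hmp : MeasurePreserving
      (fun q : (Plane × ℝ) × Closeds Plane => (q.1.2, (-q.1.1, q.2)))
      ((volume : Measure (Plane × ℝ)).prod μ)
      ((volume : Measure ℝ).prod ((volume : Measure Plane).prod μ)) :=
    ((MeasurePreserving.id (volume : Measure ℝ)).prod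
      ((Measure.measurePreserving_neg (volume : Measure Plane)).prod
        (MeasurePreserving.id μ))).comp
      ((measurePreserving_prodAssoc (volume : Measure ℝ) (volume : Measure Plane) μ).comp
        ((Measure.measurePreserving_swap (μ := (volume : Measure Plane))
          (ν := (volume : Measure ℝ))).prod (MeasurePreserving.id μ)))
  have hpre := hmp.measure_preimage hB.nullMeasurableSet
  have h := hM.poisson.measure_marked_void hM.measurable_grain hM.grain_law hM.grain_indep
    hM.grain_indep_points (hmp.measurable hB) (by rwa [hpre])
  rw [hpre] at h
  rw [measureReal_def, measureReal_def, ← ENNReal.toReal_ofReal (Real.exp_pos _).le, ← h]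
  rfl

variable {C H : Set (Plane × Closeds Plane)}

lemma real_volume_prod {κ : Measure (Plane × Closeds Plane)} [SFinite κ] {T : Set ℝ} {l : ℝ}
    (hT : volume T = ENNReal.ofReal l) (hl : 0 ≤ l) (D : Set (Plane × Closeds Plane)) :
    ((volume : Measure ℝ).prod κ).real (T ×ˢ D) = l * κ.real D := by
  rw [measureReal_def, Measure.prod_prod, hT, ENNReal.toReal_mul, ENNReal.toReal_ofReal hl,
    measureReal_def]

lemma measureReal_voidEvent_diff (hM : M.IsDeadLeaves μ)
    {B₁ B₂ : Set (ℝ × (Plane × Closeds Plane))} (h₁ : MeasurableSet B₁) (h₂ : MeasurableSet B₂)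
    (hd : Disjoint B₁ B₂)
    (hf₁ : ((volume : Measure ℝ).prod ((volume : Measure Plane).prod μ)) B₁ ≠ ⊤)
    (hf₂ : ((volume : Measure ℝ).prod ((volume : Measure Plane).prod μ)) B₂ ≠ ⊤) :
    M.P.real (M.voidEvent B₁ \ M.voidEvent (B₁ ∪ B₂)) =
      Real.exp (-((volume : Measure ℝ).prod ((volume : Measure Plane).prod μ)).real B₁) *
        (1 - Real.exp (-((volume : Measure ℝ).prod ((volume : Measure Plane).prod μ)).real B₂)) := by
  have hsub : M.voidEvent (B₁ ∪ B₂) ⊆ M.voidEvent B₁ := fun ω h i hi => h i (Or.inl hi)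
  have := hM.isProbabilityMeasure
  rw [measureReal_sdiff hsub (hM.measurableSet_voidEvent (h₁.union h₂)),
    hM.measureReal_voidEvent h₁ hf₁, hM.measureReal_voidEvent (h₁.union h₂)
      (measure_union_ne_top hf₁ hf₂), measureReal_union hd h₂ hf₁ hf₂, neg_add, Real.exp_add]
  ring

lemma volume_prod_ne_top {κ : Measure (Plane × Closeds Plane)} [SFinite κ] {T : Set ℝ} {l : ℝ}
    (hT : volume T = ENNReal.ofReal l) {D : Set (Plane × Closeds Plane)} (hD : κ D ≠ ⊤) :
    ((volume : Measure ℝ).prod κ) (T ×ˢ D) ≠ ⊤ := by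
  rw [Measure.prod_prod, hT]
  exact ENNReal.mul_ne_top ENNReal.ofReal_ne_top hD

/-- The probability that the last leaf whose mark is in `H` has its mark in `C` is at most the
ratio of the intensities. -/
lemma lastHitEvent_mul_le (hM : M.IsDeadLeaves μ) (hC : MeasurableSet C) (hH : MeasurableSet H)
    (hCf : ((volume : Measure Plane).prod μ) C ≠ ⊤) (hHf : ((volume : Measure Plane).prod μ) H ≠ ⊤)
    (hH0 : 0 < ((volume : Measure Plane).prod μ).real H) :
    M.P.real (M.lastHitEvent C H) * ((volume : Measure Plane).prod μ).real H ≤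
      ((volume : Measure Plane).prod μ).real C := by
  have := hM.isProbabilityMeasure
  set κ := (volume : Measure Plane).prod μ
  set c := κ.real C
  set g := κ.real H
  set p := M.P.real (M.lastHitEvent C H)
  have hc : 0 ≤ c := measureReal_nonneg
  have hp : 0 ≤ p := measureReal_nonneg
  -- time is cut into slabs of length `δ`, and the last hit is looked for in slab number `k`
  have key : ∀ δ : ℝ, 0 < δ → p * g * Real.exp (-(δ * g)) ≤ c := by
    intro δ hδ
    set q := Real.exp (-(δ * g))
    have hq0 : 0 < q := Real.exp_pos _
    have hq1 : q < 1 := Real.exp_lt_one_iff.2 (neg_lt_zero.2 (mul_pos hδ hH0))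
    let B₁ : ℕ → Set (ℝ × (Plane × Closeds Plane)) := fun k => Ioo (-(k * δ)) 0 ×ˢ H
    let B₂ : ℕ → Set (ℝ × (Plane × Closeds Plane)) := fun k =>
      Icc (-((k + 1) * δ)) (-(k * δ)) ×ˢ C
    have hv₁ : ∀ k : ℕ, volume (Ioo (-(k * δ)) 0) = ENNReal.ofReal (k * δ) := fun k => by simp
    have hv₂ : ∀ k : ℕ, volume (Icc (-((k + 1) * δ)) (-(k * δ))) = ENNReal.ofReal δ := fun k => by
      rw [Real.volume_Icc]; congr 1; ring
    have hU : ∀ k, M.P.real (M.voidEvent (B₁ k) \ M.voidEvent (B₁ k ∪ B₂ k)) ≤ q ^ k * (δ * c) := by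
      intro k
      rw [hM.measureReal_voidEvent_diff (measurableSet_Ioo.prod hH) (measurableSet_Icc.prod hC) ?_
        (volume_prod_ne_top (hv₁ k) hHf) (volume_prod_ne_top (hv₂ k) hCf),
        real_volume_prod (hv₁ k) (by positivity), real_volume_prod (hv₂ k) hδ.le]
      · have e1 : Real.exp (-(k * δ * κ.real H)) = q ^ k := by
          rw [← Real.exp_nat_mul]; congr 1; ring
        rw [e1]
        have := Real.one_sub_le_exp_neg (δ * c)
        gcongr
        linarith
      · refine Set.Disjoint.set_prod_left (Set.disjoint_left.2 fun t ht ht' => ?_) _ _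
        exact absurd ht.1 (not_lt.2 ht'.2)
    have hsub : M.lastHitEvent C H ⊆ ⋃ k, (M.voidEvent (B₁ k) \ M.voidEvent (B₁ k ∪ B₂ k)) := by
      rintro ω ⟨i, hi0, hiC, hi⟩
      have hnn : 0 ≤ -M.time i ω / δ := div_nonneg (by linarith) hδ.le
      have h1 := Nat.floor_le hnn
      have h2 := Nat.lt_floor_add_one (-M.time i ω / δ)
      set k := ⌊-M.time i ω / δ⌋₊
      rw [le_div_iff₀ hδ] at h1
      rw [div_lt_iff₀ hδ] at h2
      refine mem_iUnion.2 ⟨k, fun j hj => ?_, fun h => h i (Or.inr ⟨⟨?_, ?_⟩, hiC⟩)⟩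
      · exact hi j ⟨by have := hj.1.1; dsimp only at this; linarith, hj.1.2⟩ hj.2
      · dsimp only; linarith
      · dsimp only; linarith
    have hle : M.P (M.lastHitEvent C H) ≤ ENNReal.ofReal ((1 - q)⁻¹ * (δ * c)) := by
      refine (measure_mono hsub).trans ((measure_iUnion_le _).trans ?_)
      have hs := (hasSum_geometric_of_lt_one hq0.le hq1).mul_right (δ * c)
      rw [← hs.tsum_eq, ENNReal.ofReal_tsum_of_nonneg (fun k => by positivity) hs.summable]
      refine ENNReal.tsum_le_tsum fun k => ?_
      rw [← ofReal_measureReal]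
      exact ENNReal.ofReal_le_ofReal (hU k)
    have hle' : p ≤ (1 - q)⁻¹ * (δ * c) :=
      ENNReal.toReal_le_of_le_ofReal (mul_nonneg (inv_nonneg.2 (by linarith)) (by positivity)) hle
    rw [← div_eq_inv_mul, le_div_iff₀ (by linarith)] at hle'
    have h3 : δ * g * q ≤ 1 - q := by
      have h4 := Real.add_one_le_exp (δ * g)
      have h5 : Real.exp (δ * g) * q = 1 := by rw [← Real.exp_add]; simp
      have := mul_le_mul_of_nonneg_right h4 hq0.le
      linarith
    have h6 : δ * (p * g * q) ≤ δ * c := by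
      have := mul_le_mul_of_nonneg_left h3 hp
      linarith
    exact le_of_mul_le_mul_left h6 hδ
  have hlim : Tendsto (fun δ : ℝ => p * g * Real.exp (-(δ * g))) (𝓝[>] 0) (𝓝 (p * g)) := by
    have : Continuous fun δ : ℝ => p * g * Real.exp (-(δ * g)) := by fun_prop
    have h := this.tendsto 0
    simp only [zero_mul, neg_zero, Real.exp_zero, mul_one] at h
    exact h.mono_left nhdsWithin_le_nhds
  exact le_of_tendsto hlim (by filter_upwards [self_mem_nhdsWithin] with δ hδ using key δ hδ)

/-- The reverse of `lastHitEvent_mul_le`, for marks of finite local intensity. -/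
lemma le_lastHitEvent_mul (hM : M.IsDeadLeaves μ) (hC : MeasurableSet C) (hH : MeasurableSet H)
    (hCH : C ⊆ H) (hHf : ((volume : Measure Plane).prod μ) H ≠ ⊤)
    (hH0 : 0 < ((volume : Measure Plane).prod μ).real H)
    (hloc : ∀ᵐ ω ∂M.P, ∀ T : ℝ, {i | M.time i ω ∈ Icc (-T) 0 ∧ M.mark i ω ∈ H}.Finite) :
    ((volume : Measure Plane).prod μ).real C ≤
      M.P.real (M.lastHitEvent C H) * ((volume : Measure Plane).prod μ).real H := by
  have := hM.isProbabilityMeasure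
  set κ := (volume : Measure Plane).prod μ
  have hCf : κ C ≠ ⊤ := measure_ne_top_of_subset hCH hHf
  set c := κ.real C
  set g := κ.real H
  set p := M.P.real (M.lastHitEvent C H)
  have hc : 0 ≤ c := measureReal_nonneg
  have hp : 0 ≤ p := measureReal_nonneg
  have hgc : κ.real (H \ C) = g - c := measureReal_sdiff hCH hC hHf
  have key : ∀ δ : ℝ, 0 < δ → c * Real.exp (-(δ * g)) ≤ p * g := by
    intro δ hδ
    set q := Real.exp (-(δ * g))
    have hq0 : 0 < q := Real.exp_pos _
    have hq1 : q < 1 := Real.exp_lt_one_iff.2 (neg_lt_zero.2 (mul_pos hδ hH0))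
    let S : ℕ → Set ℝ := fun k => Ioc (-((k + 1) * δ)) (-(k * δ))
    -- no hit after slab `k`, and all hits in slab `k` are in `C`
    let B₁ : ℕ → Set (ℝ × (Plane × Closeds Plane)) := fun k =>
      Ioc (-(k * δ)) 0 ×ˢ H ∪ S k ×ˢ (H \ C)
    let B₂ : ℕ → Set (ℝ × (Plane × Closeds Plane)) := fun k => S k ×ˢ C
    let E : ℕ → Set M.Ω := fun k => M.voidEvent (B₁ k) \ M.voidEvent (B₁ k ∪ B₂ k)
    have hv₁ : ∀ k : ℕ, volume (Ioc (-(k * δ)) 0) = ENNReal.ofReal (k * δ) := fun k => by simp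
    have hv₂ : ∀ k : ℕ, volume (S k) = ENNReal.ofReal δ := fun k => by
      rw [Real.volume_Ioc]; congr 1; ring
    have hm₁ : ∀ k, MeasurableSet (B₁ k) := fun k =>
      (measurableSet_Ioc.prod hH).union (measurableSet_Ioc.prod (hH.diff hC))
    have hm₂ : ∀ k, MeasurableSet (B₂ k) := fun k => measurableSet_Ioc.prod hC
    have hHCf : κ (H \ C) ≠ ⊤ := measure_ne_top_of_subset sdiff_subset hHf
    have hdS : ∀ k : ℕ, Disjoint (Ioc (-(k * δ)) 0) (S k) := fun k =>
      Set.disjoint_left.2 fun t ht ht' => absurd ht.1 (not_lt.2 ht'.2)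
    have hE : ∀ k, q ^ k * (q * (δ * c)) ≤ M.P.real (E k) := by
      intro k
      rw [hM.measureReal_voidEvent_diff (hm₁ k) (hm₂ k) ?_
        (measure_union_ne_top (volume_prod_ne_top (hv₁ k) hHf) (volume_prod_ne_top (hv₂ k) hHCf))
        (volume_prod_ne_top (hv₂ k) hCf),
        measureReal_union (Set.Disjoint.set_prod_left (hdS k) _ _)
          (measurableSet_Ioc.prod (hH.diff hC)) (volume_prod_ne_top (hv₁ k) hHf)
          (volume_prod_ne_top (hv₂ k) hHCf),
        real_volume_prod (hv₁ k) (by positivity), real_volume_prod (hv₂ k) hδ.le,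
        real_volume_prod (hv₂ k) hδ.le, hgc]
      · have e1 : Real.exp (-(k * δ * κ.real H + δ * (g - c))) = q ^ k * (q * Real.exp (δ * c)) := by
          rw [← Real.exp_nat_mul, ← Real.exp_add, ← Real.exp_add]; congr 1; ring
        have e2 : Real.exp (δ * c) * Real.exp (-(δ * c)) = 1 := by rw [← Real.exp_add]; simp
        have h1 := Real.add_one_le_exp (δ * c)
        rw [e1]
        calc q ^ k * (q * (δ * c)) ≤ q ^ k * (q * (Real.exp (δ * c) - 1)) := by gcongr; linarith
          _ = q ^ k * (q * (Real.exp (δ * c) - Real.exp (δ * c) * Real.exp (-(δ * c)))) := by rw [e2]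
          _ = _ := by ring
      · refine Set.disjoint_union_left.2 ⟨Set.Disjoint.set_prod_left (hdS k) _ _,
          Set.Disjoint.set_prod_right ?_ _ _⟩
        exact disjoint_sdiff_left
    have hEm : ∀ k, MeasurableSet (E k) := fun k =>
      (hM.measurableSet_voidEvent (hm₁ k)).diff
        (hM.measurableSet_voidEvent ((hm₁ k).union (hm₂ k)))
    have hexC : ∀ k, ∀ ω ∈ E k, ∃ i, M.time i ω ∈ S k ∧ M.mark i ω ∈ C := by
      rintro k ω ⟨h1, h2⟩
      simp only [voidEvent, mem_ofPred_eq, not_forall, not_not] at h1 h2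
      obtain ⟨i, hi⟩ := h2
      rcases hi with hi | hi
      · exact absurd hi (h1 i)
      · exact ⟨i, hi⟩
    have hlt : ∀ k l, k < l → Disjoint (E k) (E l) := by
      intro k l hkl
      refine Set.disjoint_left.2 fun ω h h' => ?_
      obtain ⟨i, hi, hiC⟩ := hexC k ω h
      refine h'.1 i (Or.inl ⟨⟨?_, ?_⟩, hCH hiC⟩)
      · have h1 : ((k : ℝ) + 1) * δ ≤ l * δ := by
          have : (k : ℝ) + 1 ≤ l := by exact_mod_cast hkl
          gcongr
        have := hi.1
        dsimp only
        linarith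
      · have : 0 ≤ (k : ℝ) * δ := by positivity
        have := hi.2
        dsimp only
        linarith
    have hEd : Pairwise (Function.onFun Disjoint E) := fun k l hkl => by
      rcases hkl.lt_or_gt with h | h
      · exact hlt k l h
      · exact (hlt l k h).symm
    have hsub : (⋃ k, E k) ≤ᵐ[M.P] M.lastHitEvent C H := by
      filter_upwards [hloc] with ω hω hωE
      obtain ⟨k, hk⟩ := mem_iUnion.1 hωE
      obtain ⟨i₀, hi₀, hi₀C⟩ := hexC k ω hk
      -- the leaf is the last one of slab `k` whose mark is in `C`
      have hfin : {i | M.time i ω ∈ S k ∧ M.mark i ω ∈ C}.Finite := by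
        refine (hω ((k + 1) * δ)).subset fun i hi => ⟨⟨hi.1.1.le, ?_⟩, hCH hi.2⟩
        have : 0 ≤ (k : ℝ) * δ := by positivity
        have := hi.1.2
        linarith
      obtain ⟨i, hi, himax⟩ := Set.exists_max_image _ (fun i => M.time i ω) hfin ⟨i₀, hi₀, hi₀C⟩
      refine ⟨i, ?_, hi.2, fun j hj hjH => ?_⟩
      · have : 0 ≤ (k : ℝ) * δ := by positivity
        have := hi.1.2
        linarith
      · by_cases hjk : M.time j ω ≤ -(k * δ)
        · have hjS : M.time j ω ∈ S k := ⟨hi.1.1.trans hj.1, hjk⟩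
          by_cases hjC : M.mark j ω ∈ C
          · exact absurd (himax j ⟨hjS, hjC⟩) (not_le.2 hj.1)
          · exact hk.1 j (Or.inr ⟨hjS, hjH, hjC⟩)
        · exact hk.1 j (Or.inl ⟨⟨not_le.1 hjk, hj.2.le⟩, hjH⟩)
    have hge : ENNReal.ofReal ((1 - q)⁻¹ * (q * (δ * c))) ≤ M.P (M.lastHitEvent C H) := by
      refine le_trans ?_ (measure_mono_ae hsub)
      have hs := (hasSum_geometric_of_lt_one hq0.le hq1).mul_right (q * (δ * c))
      rw [measure_iUnion hEd hEm, ← hs.tsum_eq,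
        ENNReal.ofReal_tsum_of_nonneg (fun k => by positivity) hs.summable]
      refine ENNReal.tsum_le_tsum fun k => ?_
      rw [← ofReal_measureReal]
      exact ENNReal.ofReal_le_ofReal (hE k)
    have hge' : (1 - q)⁻¹ * (q * (δ * c)) ≤ p :=
      (ENNReal.ofReal_le_iff_le_toReal (measure_ne_top _ _)).1 hge
    rw [← div_eq_inv_mul, div_le_iff₀ (by linarith)] at hge'
    have h3 : 1 - q ≤ δ * g := by
      have := Real.one_sub_le_exp_neg (δ * g)
      linarith
    have h6 : δ * (c * q) ≤ δ * (p * g) := by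
      have := mul_le_mul_of_nonneg_left h3 hp
      linarith
    exact le_of_mul_le_mul_left h6 hδ
  have hlim : Tendsto (fun δ : ℝ => c * Real.exp (-(δ * g))) (𝓝[>] 0) (𝓝 c) := by
    have : Continuous fun δ : ℝ => c * Real.exp (-(δ * g)) := by fun_prop
    have h := this.tendsto 0
    simp only [zero_mul, neg_zero, Real.exp_zero, mul_one] at h
    exact h.mono_left nhdsWithin_le_nhds
  exact le_of_tendsto hlim (by filter_upwards [self_mem_nhdsWithin] with δ hδ using key δ hδ)

end IsDeadLeaves
end LeafSequence

/-! ### Measurability of events on closed sets -/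

lemma IsOpen.isSigmaCompact' {X : Type*} [PseudoMetricSpace X] [SigmaCompactSpace X] {U : Set X}
    (hU : IsOpen U) : IsSigmaCompact U := by
  obtain ⟨F, hF, -, hFU, -⟩ := hU.exists_iUnion_isClosed
  rw [← hFU]
  exact isSigmaCompact_iUnion _ fun n =>
    isSigmaCompact_univ.of_isClosed_subset (hF n) (subset_univ _)

lemma measurableSet_closeds_disjoint {D : Set Plane} (hD : IsSigmaCompact D) :
    MeasurableSet {F : Closeds Plane | ∀ y ∈ D, y ∉ F} := by
  obtain ⟨K, hK, rfl⟩ := hD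
  have : {F : Closeds Plane | ∀ y ∈ ⋃ n, K n, y ∉ F} =
      ⋂ n, {F : Closeds Plane | (F : Set Plane) ∩ K n = ∅} := by
    ext F
    simp only [mem_ofPred_eq, mem_iUnion, mem_iInter, Set.eq_empty_iff_forall_notMem]
    exact ⟨fun h n y hy => h y ⟨n, hy.2⟩ hy.1, fun h y ⟨n, hn⟩ hy => h n y ⟨hy, hn⟩⟩
  rw [this]
  exact MeasurableSet.iInter fun n => MeasurableSpace.measurableSet_generateFrom ⟨_, hK n, rfl⟩

lemma measurableSet_closeds_mem (y : Plane) : MeasurableSet {F : Closeds Plane | y ∈ F} := by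
  have := (measurableSet_closeds_disjoint (isCompact_singleton (x := y)).isSigmaCompact).compl
  convert this using 1
  ext F
  simp

lemma measurableSet_closeds_superset {U : Set Plane} (hU : IsOpen U) :
    MeasurableSet {F : Closeds Plane | U ⊆ F} := by
  obtain ⟨s, hsc, hsd⟩ := TopologicalSpace.exists_countable_dense Plane
  have : {F : Closeds Plane | U ⊆ F} = ⋂ y ∈ s ∩ U, {F : Closeds Plane | y ∈ F} := by
    ext F
    simp only [mem_ofPred_eq, mem_iInter]
    refine ⟨fun h y hy => h hy.2, fun h => ?_⟩
    refine (hsd.open_subset_closure_inter hU).trans (F.isClosed.closure_subset_iff.2 ?_)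
    exact fun y hy => h y ⟨hy.2, hy.1⟩
  rw [this]
  exact MeasurableSet.biInter (hsc.mono inter_subset_left) fun y _ => measurableSet_closeds_mem y

/-- A set with open sections over the closed sets is a countable union of boxes. -/
lemma measurableSet_of_isOpen_section {S T : Type*} [TopologicalSpace S]
    [SecondCountableTopology S] [MeasurableSpace S] [OpensMeasurableSpace S] [MeasurableSpace T]
    {A : Set (S × T)} (ho : ∀ F, IsOpen {s | (s, F) ∈ A})
    (hm : ∀ b : Set S, IsOpen b → MeasurableSet {F | ∀ s ∈ b, (s, F) ∈ A}) :
    MeasurableSet A := by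
  have : A = ⋃ b ∈ countableBasis S, b ×ˢ {F | ∀ s ∈ b, (s, F) ∈ A} := by
    ext ⟨s, F⟩
    simp only [mem_iUnion, mem_prod, mem_ofPred_eq, exists_prop]
    refine ⟨fun h => ?_, fun ⟨b, _, hs, hb⟩ => hb s hs⟩
    obtain ⟨b, hb, hsb, hbA⟩ :=
      (isBasis_countableBasis S).exists_subset_of_mem_open (show s ∈ {s | (s, F) ∈ A} from h) (ho F)
    exact ⟨b, hb, hsb, fun t ht => hbA ht⟩
  rw [this]
  exact MeasurableSet.biUnion (countable_countableBasis S) fun b hb =>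
    (isOpen_of_mem_countableBasis hb).measurableSet.prod (hm b (isOpen_of_mem_countableBasis hb))

lemma measurableSet_mem_closeds : MeasurableSet {z : Plane × Closeds Plane | z.1 ∈ z.2} := by
  have : MeasurableSet {z : Plane × Closeds Plane | z.1 ∉ z.2} :=
    measurableSet_of_isOpen_section (fun F => F.isClosed.isOpen_compl)
      (fun b hb => measurableSet_closeds_disjoint hb.isSigmaCompact')
  simpa [compl_ofPred] using this.compl

lemma measurableSet_mem_interior :
    MeasurableSet {z : Plane × Closeds Plane | z.1 ∈ interior (z.2 : Set Plane)} := by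
  refine measurableSet_of_isOpen_section (fun F => ?_) (fun b hb => ?_)
  · simpa only [mem_ofPred_eq, ofPred_mem_eq] using isOpen_interior
  · convert measurableSet_closeds_superset hb using 2
    ext F
    rw [← hb.subset_interior_iff]
    exact Iff.rfl

/-- Homothety is jointly measurable; the ratio is written as an exponential to be positive. -/
lemma measurable_scaleCloseds_exp :
    Measurable fun q : ℝ × Closeds Plane => scaleCloseds (Real.exp q.1) q.2 := by
  refine measurable_generateFrom ?_
  rintro _ ⟨K, hK, rfl⟩
  have : (fun q : ℝ × Closeds Plane => scaleCloseds (Real.exp q.1) q.2) ⁻¹'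
      {F : Closeds Plane | (F : Set Plane) ∩ K = ∅} =
      {q : ℝ × Closeds Plane | ∀ y ∈ K, (Real.exp q.1)⁻¹ • y ∉ q.2} := by
    ext ⟨s, F⟩
    simp only [mem_preimage, mem_ofPred_eq, Set.eq_empty_iff_forall_notMem, mem_inter_iff, not_and']
    refine forall₂_congr fun y _ => not_congr ?_
    exact mem_smul_set_iff_inv_smul_mem₀ (Real.exp_pos s).ne' _ _
  rw [this]
  have hcont : Continuous fun z : ℝ × Plane => (Real.exp z.1)⁻¹ • z.2 := by
    refine Continuous.smul (Continuous.inv₀ (by fun_prop) fun z => (Real.exp_pos _).ne')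
      continuous_snd
  refine measurableSet_of_isOpen_section (fun F => ?_) (fun b hb => ?_)
  · rw [isOpen_iff_eventually]
    intro s hs
    refine hK.eventually_forall_of_forall_eventually (P := fun s y => (Real.exp s)⁻¹ • y ∉ F)
      fun y hy => ?_
    exact hcont.continuousAt.eventually_mem (x := (s, y)) (F.isClosed.isOpen_compl.mem_nhds (hs y hy))
  · have hσ : IsSigmaCompact (b ×ˢ K) := by
      obtain ⟨L, hL, rfl⟩ := hb.isSigmaCompact'
      exact ⟨fun n => L n ×ˢ K, fun n => (hL n).prod hK, by rw [iUnion_prod_const]⟩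
    convert measurableSet_closeds_disjoint (hσ.image hcont) using 2
    ext F
    simp only [mem_ofPred_eq, mem_image, mem_prod, Prod.exists, forall_exists_index, and_imp]
    exact ⟨fun h _ s y hs hy e => e ▸ h s hs y hy, fun h s hs y hy => h _ s y hs hy rfl⟩

lemma aemeasurable_scaleCloseds {ρ : Measure ℝ} [SFinite ρ] {ν : Measure (Closeds Plane)}
    [SFinite ν] (hρ : ∀ᵐ r ∂ρ, 0 < r) :
    AEMeasurable (fun q : ℝ × Closeds Plane => scaleCloseds q.1 q.2) (ρ.prod ν) := by
  refine ⟨fun q => scaleCloseds (Real.exp (Real.log q.1)) q.2, ?_, ?_⟩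
  · exact measurable_scaleCloseds_exp.comp
      ((Real.measurable_log.comp measurable_fst).prodMk measurable_snd)
  · filter_upwards [Measure.quasiMeasurePreserving_fst.ae hρ] with q hq
    rw [Real.exp_log hq]

/-- The pairs `(q, F)` with both `q` and `q + h` in the interior of `F`. -/
def bothInterior (h : Plane) : Set (Plane × Closeds Plane) :=
  {z | z.1 ∈ interior (z.2 : Set Plane) ∧ z.1 + h ∈ interior (z.2 : Set Plane)}

/-- The pairs `(q, F)` with `q` or `q + h` in the interior of `F`. -/
def eitherInterior (h : Plane) : Set (Plane × Closeds Plane) :=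
  {z | z.1 ∈ interior (z.2 : Set Plane) ∨ z.1 + h ∈ interior (z.2 : Set Plane)}

/-- The pairs `(q, F)` with `q` or `q + h` in `F`. -/
def eitherMem (h : Plane) : Set (Plane × Closeds Plane) :=
  {z | z.1 ∈ z.2 ∨ z.1 + h ∈ z.2}

lemma measurable_shift (h : Plane) :
    Measurable fun z : Plane × Closeds Plane => (z.1 + h, z.2) :=
  (measurable_fst.add_const h).prodMk measurable_snd

lemma measurableSet_bothInterior (h : Plane) : MeasurableSet (bothInterior h) :=
  measurableSet_mem_interior.inter (measurable_shift h measurableSet_mem_interior)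

lemma measurableSet_eitherInterior (h : Plane) : MeasurableSet (eitherInterior h) :=
  measurableSet_mem_interior.union (measurable_shift h measurableSet_mem_interior)

lemma measurableSet_eitherMem (h : Plane) : MeasurableSet (eitherMem h) :=
  measurableSet_mem_closeds.union (measurable_shift h measurableSet_mem_closeds)

lemma bothInterior_subset_eitherInterior (h : Plane) : bothInterior h ⊆ eitherInterior h :=
  fun _ hz => Or.inl hz.1

lemma eitherInterior_subset_eitherMem (h : Plane) : eitherInterior h ⊆ eitherMem h :=
  fun _ hz => hz.imp (fun h => interior_subset h) (fun h => interior_subset h)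

/-! ### The visible part that contains two points -/

namespace LeafSequence

/-- If `0` and `x` are interior to the visible part of a leaf, then both are interior to this leaf
and interior to no later one. -/
lemma subset_lastHitEvent (M : LeafSequence.{u}) (x : Plane) :
    {ω | ∃ i, M.time i ω ≤ 0 ∧ {0, x} ⊆ interior (M.visiblePart i ω)} ⊆
      M.lastHitEvent (bothInterior x) (eitherInterior x) := by
  rintro ω ⟨i, hi, hsub⟩
  have h1 : ∀ y ∈ ({0, x} : Set Plane), -M.pos i ω + y ∈ interior (M.grain i ω : Set Plane) := by
    intro y hy
    have := interior_mono sdiff_subset (hsub hy)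
    rwa [interior_vadd, mem_vadd_set_iff_neg_vadd_mem] at this
  have h2 : ∀ y ∈ ({0, x} : Set Plane), ∀ j, M.time j ω ∈ Ioo (M.time i ω) 0 →
      -M.pos j ω + y ∉ interior (M.grain j ω : Set Plane) := by
    intro y hy j hj h
    refine (interior_subset (hsub hy)).2 (mem_biUnion (x := j) hj ?_)
    rwa [mem_vadd_set_iff_neg_vadd_mem]
  refine ⟨i, hi, ⟨by simpa [mark] using h1 0 (by simp), h1 x (by simp)⟩, fun j hj => ?_⟩
  rintro (h | h)
  · exact h2 0 (by simp) j hj (by simpa [mark] using h)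
  · exact h2 x (by simp) j hj h

variable {M : LeafSequence.{u}} {μ : Measure (Closeds Plane)}

lemma IsDeadLeaves.ae_finite (hM : M.IsDeadLeaves μ) :
    ∀ᵐ ω ∂M.P, ∀ ρ T : ℝ, {i | M.time i ω ∈ Icc (-T) 0 ∧ ‖M.pos i ω‖ ≤ ρ}.Finite := by
  have h : ∀ n : ℕ, ∀ᵐ ω ∂M.P,
      {i | (M.pos i ω, M.time i ω) ∈ Metric.closedBall (0 : Plane) n ×ˢ Icc (-n : ℝ) 0}.Finite := by
    intro n
    refine hM.poisson.ae_finite (Metric.isClosed_closedBall.measurableSet.prod measurableSet_Icc) ?_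
    exact ((isCompact_closedBall _ _).prod isCompact_Icc).measure_lt_top
  filter_upwards [ae_all_iff.2 h] with ω hω ρ T
  obtain ⟨n, hn⟩ := exists_nat_ge (max ρ T)
  refine (hω n).subset fun i hi => ⟨?_, ?_, hi.1.2⟩
  · rw [mem_closedBall_zero_iff]
    exact hi.2.trans ((le_max_left _ _).trans hn)
  · have := hi.1.1
    have := (le_max_right ρ T).trans hn
    linarith

/-- When the leaves are uniformly bounded, only finitely many of them can hit a neighbourhood of
the two points after leaf `i`, so that both points are interior to the visible part. -/
lemma IsDeadLeaves.lastHitEvent_le (hM : M.IsDeadLeaves μ) {ρ : ℝ}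
    (hρ : ∀ᵐ F : Closeds Plane ∂μ, (F : Set Plane) ⊆ Metric.closedBall 0 ρ) (x : Plane) :
    M.lastHitEvent (bothInterior x) (eitherMem x) ≤ᵐ[M.P]
      ({ω | ∃ i, M.time i ω ≤ 0 ∧ {0, x} ⊆ interior (M.visiblePart i ω)} : Set M.Ω) := by
  have hb : ∀ᵐ ω ∂M.P, ∀ i, (M.grain i ω : Set Plane) ⊆ Metric.closedBall 0 ρ :=
    ae_all_iff.2 fun i => ae_of_ae_map (hM.measurable_grain i).aemeasurable
      (by rw [hM.grain_law i]; exact hρ)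
  filter_upwards [hM.ae_finite, hb] with ω hfin hbd
  rintro ⟨i, hi, hiC, hlast⟩
  refine ⟨i, hi, ?_⟩
  -- `J` contains the later leaves that may meet the ball of radius `‖x‖ + 1`
  set J := {j | M.time j ω ∈ Icc (-(-M.time i ω)) 0 ∧ ‖M.pos j ω‖ ≤ ρ + (‖x‖ + 1)} ∩
    {j | M.time j ω ∈ Ioo (M.time i ω) 0}
  have hJ : J.Finite := (hfin _ _).subset inter_subset_left
  set O : Set Plane := (M.pos i ω +ᵥ interior (M.grain i ω : Set Plane)) ∩
    (Metric.ball 0 (‖x‖ + 1) ∩ ⋂ j ∈ J, (M.pos j ω +ᵥ (M.grain j ω : Set Plane))ᶜ)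
  have hO : IsOpen O := (isOpen_interior.vadd _).inter (Metric.isOpen_ball.inter
    (hJ.isOpen_biInter fun j _ => ((M.grain j ω).isClosed.vadd _).isOpen_compl))
  have hOV : O ⊆ M.visiblePart i ω := by
    rintro y ⟨hy1, hy2, hy3⟩
    refine ⟨vadd_set_mono interior_subset hy1, fun hy => ?_⟩
    obtain ⟨j, hj, hyj⟩ := mem_iUnion₂.1 hy
    have hyj' : y ∈ M.pos j ω +ᵥ (M.grain j ω : Set Plane) := vadd_set_mono interior_subset hyj
    refine mem_iInter₂.1 hy3 j ⟨⟨⟨?_, hj.2.le⟩, ?_⟩, hj⟩ hyj'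
    · rw [neg_neg]; exact hj.1.le
    · have h1 := hbd j (mem_vadd_set_iff_neg_vadd_mem.1 hyj')
      rw [mem_closedBall_zero_iff, vadd_eq_add] at h1
      rw [mem_ball_zero_iff] at hy2
      have h2 := norm_sub_le y (-M.pos j ω + y)
      have h3 : y - (-M.pos j ω + y) = M.pos j ω := by abel
      rw [h3] at h2
      linarith
  refine (interior_maximal hOV hO).trans' ?_
  have hno : ∀ j ∈ J, M.mark j ω ∉ eitherMem x := fun j hj => hlast j hj.2
  rintro y (rfl | rfl)
  · refine ⟨?_, by simp; positivity, mem_iInter₂.2 fun j hj h => hno j hj (Or.inl ?_)⟩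
    · rw [mem_vadd_set_iff_neg_vadd_mem]; simpa [mark] using hiC.1
    · rw [mem_vadd_set_iff_neg_vadd_mem] at h; simpa [mark] using h
  · refine ⟨?_, by simp, mem_iInter₂.2 fun j hj h => hno j hj (Or.inr ?_)⟩
    · rw [mem_vadd_set_iff_neg_vadd_mem]; simpa [mark] using hiC.2
    · rw [mem_vadd_set_iff_neg_vadd_mem] at h; simpa [mark] using h

/-- The intensity of the leaves that contain both points bounds from above the product of the
probability of a common visible part with the intensity of the leaves that hit one of the points. -/
lemma IsDeadLeaves.sameVisibleProb_mul_le (hM : M.IsDeadLeaves μ) (x : Plane)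
    (hf : ((volume : Measure Plane).prod μ) (eitherInterior x) ≠ ⊤)
    (h0 : 0 < ((volume : Measure Plane).prod μ).real (eitherInterior x)) :
    M.sameVisibleProb x * ((volume : Measure Plane).prod μ).real (eitherInterior x) ≤
      ((volume : Measure Plane).prod μ).real (bothInterior x) := by
  refine le_trans ?_ (hM.lastHitEvent_mul_le (measurableSet_bothInterior x)
    (measurableSet_eitherInterior x)
    (measure_ne_top_of_subset (bothInterior_subset_eitherInterior x) hf) hf h0)
  exact mul_le_mul_of_nonneg_right (measureReal_mono (M.subset_lastHitEvent x)) h0.le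

/-- The reverse of `sameVisibleProb_mul_le`, for uniformly bounded grains with null boundaries. -/
lemma IsDeadLeaves.le_sameVisibleProb_mul (hM : M.IsDeadLeaves μ) (x : Plane) {ρ : ℝ}
    (hρ : ∀ᵐ F : Closeds Plane ∂μ, (F : Set Plane) ⊆ Metric.closedBall 0 ρ)
    (hnull : ∀ᵐ F : Closeds Plane ∂μ, volume (frontier (F : Set Plane)) = 0)
    (hf : ((volume : Measure Plane).prod μ) (eitherInterior x) ≠ ⊤)
    (h0 : 0 < ((volume : Measure Plane).prod μ).real (eitherInterior x)) :
    ((volume : Measure Plane).prod μ).real (bothInterior x) ≤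
      M.sameVisibleProb x * ((volume : Measure Plane).prod μ).real (eitherInterior x) := by
  have := hM.isProbabilityMeasure
  have hb : ∀ᵐ z ∂((volume : Measure Plane).prod μ), z.1 ∈ z.2 →
      z.1 ∈ interior (z.2 : Set Plane) := by
    have hm : MeasurableSet {z : Plane × Closeds Plane | z.1 ∈ z.2 →
        z.1 ∈ interior (z.2 : Set Plane)} := by
      convert measurableSet_mem_closeds.compl.union measurableSet_mem_interior using 1
      ext z
      simp [imp_iff_not_or]
    rw [ae_iff, ← compl_ofPred, Measure.prod_apply_symm hm.compl, lintegral_eq_zero_iff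
      (measurable_measure_prodMk_right hm.compl)]
    filter_upwards [hnull] with F hF
    refine Eq.trans (congrArg volume ?_) hF
    ext q
    simp [F.isClosed.frontier_eq]
  have hs : MeasurePreserving (fun z : Plane × Closeds Plane => (z.1 + x, z.2))
      ((volume : Measure Plane).prod μ) ((volume : Measure Plane).prod μ) :=
    (measurePreserving_add_right volume x).prod (MeasurePreserving.id μ)
  have hae : eitherMem x =ᵐ[(volume : Measure Plane).prod μ] eitherInterior x := by
    refine Filter.EventuallyLE.antisymm ?_ (eitherInterior_subset_eitherMem x).eventuallyLE
    filter_upwards [hb, hs.quasiMeasurePreserving.ae hb] with z h1 h2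
    exact Or.imp h1 h2
  rw [← measureReal_congr hae] at h0 ⊢
  rw [← measure_congr hae] at hf
  refine (hM.le_lastHitEvent_mul (measurableSet_bothInterior x) (measurableSet_eitherMem x)
    ((bothInterior_subset_eitherInterior x).trans (eitherInterior_subset_eitherMem x)) hf h0
    ?_).trans ?_
  · have hbd : ∀ᵐ ω ∂M.P, ∀ i, (M.grain i ω : Set Plane) ⊆ Metric.closedBall 0 ρ :=
      ae_all_iff.2 fun i => ae_of_ae_map (hM.measurable_grain i).aemeasurable
        (by rw [hM.grain_law i]; exact hρ)
    filter_upwards [hM.ae_finite, hbd] with ω hω hbω T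
    refine (hω (ρ + ‖x‖) T).subset fun i hi => ⟨hi.1, ?_⟩
    rcases hi.2 with h | h
    · have := hbω i h
      simp only [mark, mem_closedBall_zero_iff, norm_neg] at this
      have := norm_nonneg x
      linarith
    · have := hbω i h
      simp only [mark, mem_closedBall_zero_iff] at this
      have h2 := norm_sub_le x (-M.pos i ω + x)
      have h3 : x - (-M.pos i ω + x) = M.pos i ω := by abel
      rw [h3] at h2
      linarith
  · refine mul_le_mul_of_nonneg_right ?_ h0.le
    exact ENNReal.toReal_mono (measure_ne_top _ _) (measure_mono_ae (hM.lastHitEvent_le hρ x))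

end LeafSequence

/-! ### The mean overlap of a grain with its translates -/

/-- The mean area of the intersection of the interior of a random closed set of law `ν` with its
translate by `-h`. At `h = 0` this is the mean area of the interior. -/
noncomputable def meanOverlap (ν : Measure (Closeds Plane)) (h : Plane) : ℝ :=
  ((volume : Measure Plane).prod ν).real (bothInterior h)

lemma bothInterior_subset_zero (h : Plane) : bothInterior h ⊆ bothInterior 0 :=
  fun z hz => ⟨hz.1, by simpa using hz.1⟩

lemma meanOverlap_nonneg (ν : Measure (Closeds Plane)) (h : Plane) : 0 ≤ meanOverlap ν h := measureReal_nonneg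

lemma meanOverlap_eq_zero {ν : Measure (Closeds Plane)} [SFinite ν] {a₂ : ℝ}
    (hν : ∀ᵐ F : Closeds Plane ∂ν, (F : Set Plane) ⊆ Metric.closedBall 0 a₂) {h : Plane}
    (hh : 2 * a₂ < ‖h‖) : meanOverlap ν h = 0 := by
  have : bothInterior h ≤ᵐ[(volume : Measure Plane).prod ν] (∅ : Set _) := by
    filter_upwards [Measure.quasiMeasurePreserving_snd.ae hν] with z hz hzb
    have h1 := hz (interior_subset hzb.1)
    have h2 := hz (interior_subset hzb.2)
    rw [mem_closedBall_zero_iff] at h1 h2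
    have h3 := norm_sub_le (z.1 + h) z.1
    rw [add_sub_cancel_left] at h3
    linarith
  rw [meanOverlap, measureReal_def, measure_mono_null_ae this measure_empty, ENNReal.toReal_zero]

section Overlap

variable {ν : Measure (Closeds Plane)} [IsProbabilityMeasure ν] {a₁ a₂ : ℝ}

lemma measure_bothInterior_zero_ne_top
    (hν : ∀ᵐ F : Closeds Plane ∂ν, (F : Set Plane) ⊆ Metric.closedBall 0 a₂) :
    ((volume : Measure Plane).prod ν) (bothInterior 0) ≠ ⊤ := by
  have h : bothInterior 0 ≤ᵐ[(volume : Measure Plane).prod ν]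
      (Metric.closedBall (0 : Plane) a₂ ×ˢ (univ : Set (Closeds Plane)) : Set _) := by
    filter_upwards [Measure.quasiMeasurePreserving_snd.ae hν] with z hz hzb
    exact ⟨hz (interior_subset hzb.1), mem_univ _⟩
  refine ne_top_of_le_ne_top ?_ (measure_mono_ae h)
  rw [Measure.prod_prod]
  exact ENNReal.mul_ne_top measure_closedBall_lt_top.ne (measure_ne_top _ _)

lemma measure_bothInterior_ne_top
    (hν : ∀ᵐ F : Closeds Plane ∂ν, (F : Set Plane) ⊆ Metric.closedBall 0 a₂) (h : Plane) :
    ((volume : Measure Plane).prod ν) (bothInterior h) ≠ ⊤ :=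
  measure_ne_top_of_subset (bothInterior_subset_zero h) (measure_bothInterior_zero_ne_top hν)

lemma meanOverlap_le (hν : ∀ᵐ F : Closeds Plane ∂ν, (F : Set Plane) ⊆ Metric.closedBall 0 a₂)
    (h : Plane) : meanOverlap ν h ≤ meanOverlap ν 0 :=
  measureReal_mono (bothInterior_subset_zero h) (measure_bothInterior_zero_ne_top hν)

lemma meanOverlap_zero_pos (ha₁ : 0 < a₁)
    (hν : ∀ᵐ F : Closeds Plane ∂ν, Metric.ball 0 a₁ ⊆ (F : Set Plane) ∧
      (F : Set Plane) ⊆ Metric.closedBall 0 a₂) : 0 < meanOverlap ν 0 := by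
  have h : (Metric.ball (0 : Plane) a₁ ×ˢ (univ : Set (Closeds Plane)) : Set _)
      ≤ᵐ[(volume : Measure Plane).prod ν] bothInterior 0 := by
    filter_upwards [Measure.quasiMeasurePreserving_snd.ae hν] with z hz hzb
    have := interior_maximal hz.1 Metric.isOpen_ball hzb.1
    exact ⟨this, by simpa using this⟩
  refine ENNReal.toReal_pos ?_ (measure_bothInterior_zero_ne_top (hν.mono fun _ h => h.2))
  refine (lt_of_lt_of_le ?_ (measure_mono_ae h)).ne'
  rw [Measure.prod_prod, measure_univ, mul_one]
  exact Metric.measure_ball_pos _ _ ha₁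

/-- The mean overlap is continuous at `0`: a point of an open set stays in it after a small
translation. -/
lemma tendsto_meanOverlap
    (hν : ∀ᵐ F : Closeds Plane ∂ν, (F : Set Plane) ⊆ Metric.closedBall 0 a₂) :
    Tendsto (meanOverlap ν) (𝓝 0) (𝓝 (meanOverlap ν 0)) := by
  refine (ENNReal.tendsto_toReal (measure_bothInterior_zero_ne_top hν)).comp ?_
  refine tendsto_measure_of_tendsto_indicator (B := bothInterior 0) (𝓝 0) ?_ ?_ ?_ ?_ ?_
  · exact fun h => measurableSet_bothInterior h
  · exact measurableSet_bothInterior 0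
  · exact measure_bothInterior_zero_ne_top hν
  · exact Eventually.of_forall bothInterior_subset_zero
  · intro z
    by_cases hz : z.1 ∈ interior (z.2 : Set Plane)
    · have hc : ContinuousAt (fun h : Plane => z.1 + h) 0 := by fun_prop
      have := hc.eventually_mem (isOpen_interior.mem_nhds (by simpa using hz))
      filter_upwards [this] with h hh
      exact ⟨fun _ => ⟨hz, by simpa using hz⟩, fun _ => ⟨hz, hh⟩⟩
    · exact Eventually.of_forall fun h => ⟨fun h' => absurd h'.1 hz, fun h' => absurd h'.1 hz⟩

lemma measurable_meanOverlap : Measurable (meanOverlap ν) := by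
  have : MeasurableSet {w : Plane × (Plane × Closeds Plane) | w.2 ∈ bothInterior w.1} := by
    have hs : Measurable fun w : Plane × (Plane × Closeds Plane) => (w.2.1 + w.1, w.2.2) :=
      (measurable_snd.fst.add measurable_fst).prodMk measurable_snd.snd
    exact (measurable_snd measurableSet_mem_interior).inter (hs measurableSet_mem_interior)
  exact (measurable_measure_prodMk_left this).ennreal_toReal

/-- Inclusion and exclusion for the interior and its translate. -/
lemma measure_eitherInterior
    (hν : ∀ᵐ F : Closeds Plane ∂ν, (F : Set Plane) ⊆ Metric.closedBall 0 a₂) (h : Plane) :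
    ((volume : Measure Plane).prod ν) (eitherInterior h) ≠ ⊤ ∧
    ((volume : Measure Plane).prod ν).real (eitherInterior h) =
      2 * meanOverlap ν 0 - meanOverlap ν h := by
  set κ := (volume : Measure Plane).prod ν
  set I : Set (Plane × Closeds Plane) := {z | z.1 ∈ interior (z.2 : Set Plane)}
  set I' : Set (Plane × Closeds Plane) := {z | z.1 + h ∈ interior (z.2 : Set Plane)}
  have hI : bothInterior 0 = I := by ext z; simp [bothInterior, I]
  have hs : MeasurePreserving (fun z : Plane × Closeds Plane => (z.1 + h, z.2)) κ κ :=
    (measurePreserving_add_right volume h).prod (MeasurePreserving.id ν)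
  have hI' : κ I' = κ I := hs.measure_preimage measurableSet_mem_interior.nullMeasurableSet
  have hIf : κ I ≠ ⊤ := hI ▸ measure_bothInterior_zero_ne_top hν
  have h1 : κ (eitherInterior h) ≠ ⊤ := measure_union_ne_top hIf (hI' ▸ hIf)
  refine ⟨h1, ?_⟩
  have h2 : κ (eitherInterior h) + κ (bothInterior h) = κ I + κ I' :=
    measure_union_add_inter I (measurable_shift h measurableSet_mem_interior)
  have h3 := congrArg ENNReal.toReal h2
  rw [hI', ENNReal.toReal_add h1 (measure_bothInterior_ne_top hν h), ENNReal.toReal_add hIf hIf]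
    at h3
  rw [meanOverlap, meanOverlap, hI]
  simp only [measureReal_def]
  linarith

end Overlap

/-! ### Intensities of scaled grains -/

lemma measurableSet_radiusRange (r₀ : ℝ) (r₁ : EReal) : MeasurableSet (radiusRange r₀ r₁) :=
  measurableSet_Ici.inter (measurable_coe_real_ereal measurableSet_Iic)

lemma radiusRange_coe (r₀ r₁ : ℝ) : radiusRange r₀ (r₁ : EReal) = Icc r₀ r₁ := by
  ext r; simp [radiusRange]

lemma radiusRange_subset_Ici (r₀ : ℝ) (r₁ : EReal) : radiusRange r₀ r₁ ⊆ Ici r₀ := fun _ h => h.1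

lemma integrableOn_rpow_radiusRange {β r₀ : ℝ} {r₁ : EReal} (h0 : 0 < r₀)
    (h : r₁ ≠ ⊤ ∨ β < -1) : IntegrableOn (fun r : ℝ => r ^ β) (radiusRange r₀ r₁) := by
  rcases h with h | h
  · induction r₁ with
    | bot => 
      have : radiusRange r₀ ⊥ = ∅ := by ext r; simp [radiusRange]
      simp [this]
    | top => exact absurd rfl h
    | coe r₁ =>
      rw [radiusRange_coe]
      refine ContinuousOn.integrableOn_Icc fun r hr => ?_
      exact (Real.continuousAt_rpow_const _ _
        (Or.inl (h0.trans_le hr.1).ne')).continuousWithinAt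
  · refine IntegrableOn.mono_set ?_ (radiusRange_subset_Ici r₀ r₁)
    exact (integrableOn_Ici_iff_integrableOn_Ioi (by simp)).2 (integrableOn_Ioi_rpow_of_lt h h0)

lemma volume_radiusRange_pos {r₀ : ℝ} {r₁ : EReal} (h : (r₀ : EReal) < r₁) :
    0 < volume (radiusRange r₀ r₁) := by
  obtain ⟨s, hs, hs'⟩ := EReal.lt_iff_exists_real_btwn.1 h
  have hs₀ : r₀ < s := by exact_mod_cast hs
  refine lt_of_lt_of_le ?_ (measure_mono (show Icc r₀ s ⊆ radiusRange r₀ r₁ from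
    fun r hr => ⟨hr.1, (EReal.coe_le_coe_iff.2 hr.2).trans hs'.le⟩))
  simpa using hs₀

lemma setIntegral_radiusRange_pos {r₀ : ℝ} {r₁ : EReal} (h0 : 0 < r₀) (h : (r₀ : EReal) < r₁)
    {φ : ℝ → ℝ} (hφ : ∀ r, 0 < r → 0 < φ r) (hi : IntegrableOn φ (radiusRange r₀ r₁)) :
    0 < ∫ r in radiusRange r₀ r₁, φ r := by
  have hpos : ∀ r ∈ radiusRange r₀ r₁, 0 < φ r := fun r hr => hφ r (h0.trans_le hr.1)
  rw [setIntegral_pos_iff_support_of_nonneg_ae ?_ hi]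
  · refine (volume_radiusRange_pos h).trans_le (measure_mono fun r hr => ⟨?_, hr⟩)
    exact (hpos r hr).ne'
  · filter_upwards [ae_restrict_mem (measurableSet_radiusRange r₀ r₁)] with r hr
    exact (hpos r hr).le

lemma measurable_radiusDensity (α r₀ : ℝ) (r₁ : EReal) : Measurable (radiusDensity α r₀ r₁) :=
  measurable_const.mul ((measurable_id.pow_const _).indicator (measurableSet_radiusRange r₀ r₁))

lemma ae_radiusLaw_mem (α r₀ : ℝ) (r₁ : EReal) :
    ∀ᵐ r ∂(radiusLaw α r₀ r₁), r ∈ radiusRange r₀ r₁ := by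
  rw [radiusLaw, ae_withDensity_iff (measurable_radiusDensity α r₀ r₁).ennreal_ofReal]
  refine Eventually.of_forall fun r hr => ?_
  by_contra h
  exact hr (by simp [radiusDensity, h])

instance (α r₀ : ℝ) (r₁ : EReal) : SFinite (radiusLaw α r₀ r₁) := by
  unfold radiusLaw; infer_instance

lemma aemeasurable_scaleCloseds_radiusLaw {α r₀ : ℝ} {r₁ : EReal} (h0 : 0 < r₀)
    (ν : Measure (Closeds Plane)) [SFinite ν] :
    AEMeasurable (fun q : ℝ × Closeds Plane => scaleCloseds q.1 q.2)
      ((radiusLaw α r₀ r₁).prod ν) :=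
  aemeasurable_scaleCloseds ((ae_radiusLaw_mem α r₀ r₁).mono fun _ h => h0.trans_le h.1)

/-- An intensity that is compatible with homotheties is a mixture, over the law of the scaling
factor `r`, of the intensities for the unscaled grain, taken at `r⁻¹ • x`. -/
lemma measure_prod_grainLaw {α r₀ : ℝ} {r₁ : EReal} (h0 : 0 < r₀)
    (ν : Measure (Closeds Plane)) [SFinite ν] {S : Plane → Set (Plane × Closeds Plane)}
    (hS : ∀ h, MeasurableSet (S h))
    (hscale : ∀ r : ℝ, 0 < r → ∀ q F h, (r • q, scaleCloseds r F) ∈ S (r • h) ↔ (q, F) ∈ S h)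
    (x : Plane) :
    ((volume : Measure Plane).prod (grainLaw α r₀ r₁ ν)) (S x) =
      ∫⁻ r, ENNReal.ofReal (r ^ 2) * ((volume : Measure Plane).prod ν) (S (r⁻¹ • x))
        ∂(radiusLaw α r₀ r₁) := by
  have hae := aemeasurable_scaleCloseds_radiusLaw (α := α) (r₁ := r₁) h0 ν
  have hm := measurable_measure_prodMk_right (μ := (volume : Measure Plane)) (hS x)
  have hm' : AEMeasurable (fun z : ℝ × Closeds Plane =>
      volume ((fun q => (q, scaleCloseds z.1 z.2)) ⁻¹' S x)) ((radiusLaw α r₀ r₁).prod ν) :=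
    hm.comp_aemeasurable hae
  have : SFinite (grainLaw α r₀ r₁ ν) := by unfold grainLaw; infer_instance
  rw [Measure.prod_apply_symm (hS x), grainLaw, lintegral_map' hm.aemeasurable hae,
    lintegral_prod _ hm']
  refine lintegral_congr_ae ?_
  filter_upwards [ae_radiusLaw_mem α r₀ r₁] with r hr
  have hr0 : 0 < r := h0.trans_le hr.1
  rw [Measure.prod_apply_symm (hS _),
    ← lintegral_const_mul _ (measurable_measure_prodMk_right (hS _))]
  refine lintegral_congr fun F => ?_
  have : (fun q => (q, scaleCloseds r F)) ⁻¹' S x = r • ((fun q => (q, F)) ⁻¹' S (r⁻¹ • x)) := by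
    ext q
    rw [mem_smul_set_iff_inv_smul_mem₀ hr0.ne', mem_preimage, mem_preimage, ← hscale r hr0 (r⁻¹ • q),
      smul_inv_smul₀ hr0.ne', smul_inv_smul₀ hr0.ne']
  rw [this, Measure.addHaar_smul, finrank_euclideanSpace_fin, abs_of_nonneg (by positivity)]

lemma measureReal_prod_grainLaw {α r₀ : ℝ} {r₁ : EReal} (h0 : 0 < r₀)
    (ν : Measure (Closeds Plane)) [SFinite ν] {S : Plane → Set (Plane × Closeds Plane)}
    (hS : ∀ h, MeasurableSet (S h))
    (hscale : ∀ r : ℝ, 0 < r → ∀ q F h, (r • q, scaleCloseds r F) ∈ S (r • h) ↔ (q, F) ∈ S h)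
    (hfin : ∀ h, ((volume : Measure Plane).prod ν) (S h) ≠ ⊤) (x : Plane)
    (hi : IntegrableOn (fun r => r ^ (2 - α) * ((volume : Measure Plane).prod ν).real (S (r⁻¹ • x)))
      (radiusRange r₀ r₁)) :
    ((volume : Measure Plane).prod (grainLaw α r₀ r₁ ν)) (S x) ≠ ⊤ ∧
    ((volume : Measure Plane).prod (grainLaw α r₀ r₁ ν)).real (S x) =
      (∫ s in radiusRange r₀ r₁, s ^ (-α))⁻¹ *
        ∫ r in radiusRange r₀ r₁,
          r ^ (2 - α) * ((volume : Measure Plane).prod ν).real (S (r⁻¹ • x)) := by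
  set D := radiusRange r₀ r₁
  set z := (∫ s in D, s ^ (-α))⁻¹
  set φ : ℝ → ℝ := fun r => r ^ (2 - α) * ((volume : Measure Plane).prod ν).real (S (r⁻¹ • x))
  have hD : MeasurableSet D := measurableSet_radiusRange r₀ r₁
  have hDpos : ∀ r ∈ D, 0 < r := fun r hr => h0.trans_le hr.1
  have hz : 0 ≤ z := inv_nonneg.2 (setIntegral_nonneg hD fun r hr => (Real.rpow_pos_of_pos
    (hDpos r hr) _).le)
  have hφ : ∀ r ∈ D, 0 ≤ φ r := fun r hr =>
    mul_nonneg (Real.rpow_pos_of_pos (hDpos r hr) _).le measureReal_nonneg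
  have hφi : Integrable (fun r => z * D.indicator φ r) := ((integrable_indicator_iff hD).2 hi).const_mul z
  have hφ0 : ∀ r, 0 ≤ z * D.indicator φ r := fun r => mul_nonneg hz (indicator_nonneg hφ r)
  have key : ((volume : Measure Plane).prod (grainLaw α r₀ r₁ ν)) (S x) =
      ENNReal.ofReal (∫ r, z * D.indicator φ r) := by
    rw [measure_prod_grainLaw h0 ν hS hscale x, radiusLaw,
      lintegral_withDensity_eq_lintegral_mul_non_measurable _
        (measurable_radiusDensity α r₀ r₁).ennreal_ofReal
        (Eventually.of_forall fun _ => ENNReal.ofReal_lt_top),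
      ofReal_integral_eq_lintegral_ofReal hφi (Eventually.of_forall hφ0)]
    refine lintegral_congr fun r => ?_
    rw [Pi.mul_apply]
    by_cases hr : r ∈ D
    · have e : ((volume : Measure Plane).prod ν) (S (r⁻¹ • x)) =
          ENNReal.ofReal (((volume : Measure Plane).prod ν).real (S (r⁻¹ • x))) :=
        (ENNReal.ofReal_toReal (hfin _)).symm
      have hr0 := hDpos r hr
      have hw : r ^ (2 - α) = r ^ (-α) * r ^ 2 := by
        rw [← Real.rpow_natCast r 2, ← Real.rpow_add hr0]; congr 1; push_cast; ring
      have hd : radiusDensity α r₀ r₁ r = z * r ^ (-α) := by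
        rw [radiusDensity, indicator_of_mem hr]
      rw [e, ← ENNReal.ofReal_mul (by positivity), hd, ← ENNReal.ofReal_mul
        (mul_nonneg hz (Real.rpow_pos_of_pos hr0 _).le), indicator_of_mem hr]
      simp only [φ, hw]
      congr 1
      ring
    · have hd : radiusDensity α r₀ r₁ r = 0 := by
        rw [radiusDensity, indicator_of_notMem hr, mul_zero]
      simp [hd, hr]
  refine ⟨key ▸ ENNReal.ofReal_ne_top, ?_⟩
  rw [measureReal_def, key, ENNReal.toReal_ofReal (integral_nonneg hφ0), integral_const_mul,
    integral_indicator hD]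

lemma mem_interior_scaleCloseds {r : ℝ} (hr : 0 < r) {q : Plane} {F : Closeds Plane} :
    r • q ∈ interior (scaleCloseds r F : Set Plane) ↔ q ∈ interior (F : Set Plane) := by
  have : (scaleCloseds r F : Set Plane) = r • (F : Set Plane) := rfl
  rw [this, interior_smul₀ hr.ne', smul_mem_smul_set_iff₀ hr.ne']

lemma scale_mem_bothInterior (r : ℝ) (hr : 0 < r) (q : Plane) (F : Closeds Plane) (h : Plane) :
    (r • q, scaleCloseds r F) ∈ bothInterior (r • h) ↔ (q, F) ∈ bothInterior h := by
  simp only [bothInterior, mem_ofPred_eq, ← smul_add, mem_interior_scaleCloseds hr]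

lemma scale_mem_eitherInterior (r : ℝ) (hr : 0 < r) (q : Plane) (F : Closeds Plane) (h : Plane) :
    (r • q, scaleCloseds r F) ∈ eitherInterior (r • h) ↔ (q, F) ∈ eitherInterior h := by
  simp only [eitherInterior, mem_ofPred_eq, ← smul_add, mem_interior_scaleCloseds hr]

lemma measurableSet_closeds_subset_closedBall (ρ : ℝ) :
    MeasurableSet {F : Closeds Plane | (F : Set Plane) ⊆ Metric.closedBall 0 ρ} := by
  convert measurableSet_closeds_disjoint
    (Metric.isClosed_closedBall (x := (0 : Plane)) (ε := ρ)).isOpen_compl.isSigmaCompact' using 2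
  ext F
  exact ⟨fun h y hy hF => hy (h hF), fun h y hF => by_contra fun hy => h y hy hF⟩

lemma measurableSet_closeds_frontier_null :
    MeasurableSet {F : Closeds Plane | volume (frontier (F : Set Plane)) = 0} := by
  have h := measurable_measure_prodMk_right (μ := (volume : Measure Plane))
    (measurableSet_mem_closeds.diff measurableSet_mem_interior)
  convert h (measurableSet_singleton 0) using 1
  ext F
  have : frontier (F : Set Plane) = (fun q => (q, F)) ⁻¹'
      ({z : Plane × Closeds Plane | z.1 ∈ z.2} \ {z | z.1 ∈ interior (z.2 : Set Plane)}) := by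
    rw [F.isClosed.frontier_eq]; rfl
  rw [mem_ofPred_eq, this]; rfl

lemma ae_grainLaw_of_ae {α r₀ : ℝ} {r₁ : EReal} (h0 : 0 < r₀) {ν : Measure (Closeds Plane)}
    [SFinite ν] {p q : Closeds Plane → Prop} (hq : MeasurableSet {F | q F})
    (hp : ∀ᵐ F ∂ν, p F) (hpq : ∀ r ∈ radiusRange r₀ r₁, ∀ F, p F → q (scaleCloseds r F)) :
    ∀ᵐ F ∂(grainLaw α r₀ r₁ ν), q F := by
  rw [grainLaw, ae_map_iff (aemeasurable_scaleCloseds_radiusLaw h0 ν) hq]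
  filter_upwards [Measure.quasiMeasurePreserving_fst.ae (ae_radiusLaw_mem α r₀ r₁),
    Measure.quasiMeasurePreserving_snd.ae hp] with z h1 h2
  exact hpq _ h1 _ h2

lemma ae_grainLaw_frontier_null {α r₀ : ℝ} {r₁ : EReal} (h0 : 0 < r₀) {ν : Measure (Closeds Plane)}
    [SFinite ν] (hν : ∀ᵐ F : Closeds Plane ∂ν, volume (frontier (F : Set Plane)) = 0) :
    ∀ᵐ F : Closeds Plane ∂(grainLaw α r₀ r₁ ν), volume (frontier (F : Set Plane)) = 0 := by
  refine ae_grainLaw_of_ae h0 measurableSet_closeds_frontier_null hν fun r hr F hF => ?_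
  have hr0 : r ≠ 0 := (h0.trans_le hr.1).ne'
  have : (scaleCloseds r F : Set Plane) = r • (F : Set Plane) := rfl
  rw [(scaleCloseds r F).isClosed.frontier_eq, this, interior_smul₀ hr0, ← smul_set_sdiff₀ hr0,
    ← F.isClosed.frontier_eq, Measure.addHaar_smul, hF, mul_zero]

lemma ae_grainLaw_subset_closedBall {α r₀ r₁ : ℝ} (h0 : 0 < r₀) {ν : Measure (Closeds Plane)}
    [SFinite ν] {a₂ : ℝ}
    (hν : ∀ᵐ F : Closeds Plane ∂ν, (F : Set Plane) ⊆ Metric.closedBall 0 a₂) :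
    ∀ᵐ F : Closeds Plane ∂(grainLaw α r₀ r₁ ν), (F : Set Plane) ⊆ Metric.closedBall 0 (r₁ * a₂) := by
  refine ae_grainLaw_of_ae h0 (measurableSet_closeds_subset_closedBall _) hν fun r hr F hF => ?_
  rw [radiusRange_coe] at hr
  rintro _ ⟨y, hy, rfl⟩
  have h1 := hF hy
  rw [mem_closedBall_zero_iff] at h1 ⊢
  have hr0 := h0.trans_le hr.1
  rw [norm_smul, Real.norm_of_nonneg hr0.le]
  exact mul_le_mul hr.2 h1 (norm_nonneg _) (hr0.le.trans hr.2)

section Ratio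

variable {ν : Measure (Closeds Plane)} [IsProbabilityMeasure ν] {a₁ a₂ α r₀ : ℝ} {r₁ : EReal}

lemma integrableOn_rpow_mul_meanOverlap
    (hν : ∀ᵐ F : Closeds Plane ∂ν, (F : Set Plane) ⊆ Metric.closedBall 0 a₂)
    (h0 : 0 < r₀) (h : r₁ ≠ ⊤ ∨ 3 < α) (x : Plane) :
    IntegrableOn (fun r : ℝ => r ^ (2 - α) * meanOverlap ν (r⁻¹ • x)) (radiusRange r₀ r₁) := by
  refine Integrable.mul_bdd (c := meanOverlap ν 0)
    (integrableOn_rpow_radiusRange h0 (h.imp_right fun h => by linarith)) ?_ ?_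
  · exact (measurable_meanOverlap.comp
      (measurable_id.inv.smul_const x)).aestronglyMeasurable
  · refine Eventually.of_forall fun r => ?_
    rw [Real.norm_of_nonneg (meanOverlap_nonneg _ _)]
    exact meanOverlap_le hν _

/-- The intensities of the leaves that contain both points and of those that hit one of them, up to
a common factor, as integrals over the scaling factor. -/
lemma exists_intensity_eq (ha₁ : 0 < a₁)
    (hν : ∀ᵐ F : Closeds Plane ∂ν, Metric.ball 0 a₁ ⊆ (F : Set Plane) ∧
      (F : Set Plane) ⊆ Metric.closedBall 0 a₂)
    (hα : 1 < α) (h0 : 0 < r₀) (h01 : (r₀ : EReal) < r₁) (h : r₁ ≠ ⊤ ∨ 3 < α) (x : Plane) :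
    ∃ z : ℝ, 0 < z ∧
      ((volume : Measure Plane).prod (grainLaw α r₀ r₁ ν)) (eitherInterior x) ≠ ⊤ ∧
      0 < ((volume : Measure Plane).prod (grainLaw α r₀ r₁ ν)).real (eitherInterior x) ∧
      ((volume : Measure Plane).prod (grainLaw α r₀ r₁ ν)).real (eitherInterior x) =
        z * ∫ r in radiusRange r₀ r₁,
          r ^ (2 - α) * (2 * meanOverlap ν 0 - meanOverlap ν (r⁻¹ • x)) ∧
      ((volume : Measure Plane).prod (grainLaw α r₀ r₁ ν)).real (bothInterior x) =
        z * ∫ r in radiusRange r₀ r₁, r ^ (2 - α) * meanOverlap ν (r⁻¹ • x) := by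
  have hν₂ := hν.mono fun _ h => h.2
  have hfi := integrableOn_rpow_mul_meanOverlap (r₁ := r₁) hν₂ h0 h x
  have hwi := integrableOn_rpow_radiusRange (r₁ := r₁) (β := 2 - α) h0
    (h.imp_right fun h => by linarith)
  have hgi : IntegrableOn (fun r : ℝ => r ^ (2 - α) *
      (2 * meanOverlap ν 0 - meanOverlap ν (r⁻¹ • x))) (radiusRange r₀ r₁) := by
    simp only [mul_sub]
    exact (hwi.mul_const _).sub hfi
  have hz : 0 < ∫ s in radiusRange r₀ r₁, s ^ (-α) :=
    setIntegral_radiusRange_pos h0 h01 (fun r hr => Real.rpow_pos_of_pos hr _)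
      (integrableOn_rpow_radiusRange h0 (Or.inr (by linarith)))
  have hV := meanOverlap_zero_pos ha₁ hν
  have hG : 0 < ∫ r in radiusRange r₀ r₁,
      r ^ (2 - α) * (2 * meanOverlap ν 0 - meanOverlap ν (r⁻¹ • x)) := by
    refine setIntegral_radiusRange_pos h0 h01 (fun r hr => ?_) hgi
    have := meanOverlap_le hν₂ (r⁻¹ • x)
    exact mul_pos (Real.rpow_pos_of_pos hr _) (by linarith)
  have hE := measureReal_prod_grainLaw (α := α) (r₁ := r₁) h0 ν measurableSet_eitherInterior
    scale_mem_eitherInterior (fun h => (measure_eitherInterior hν₂ h).1) x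
    (by simp_rw [(measure_eitherInterior hν₂ _).2]; exact hgi)
  simp_rw [(measure_eitherInterior hν₂ _).2] at hE
  have hB := measureReal_prod_grainLaw (α := α) (r₁ := r₁) h0 ν measurableSet_bothInterior
    scale_mem_bothInterior (measure_bothInterior_ne_top hν₂) x hfi
  refine ⟨_, inv_pos.2 hz, hE.1, ?_, hE.2, hB.2⟩
  rw [hE.2]
  exact mul_pos (inv_pos.2 hz) hG

/-! ### The visibility probability as a ratio of integrals -/

namespace LeafSequence.IsDeadLeaves

variable {M : LeafSequence.{u}}

lemma sameVisibleProb_mul_integral_le (hM : M.IsDeadLeaves (grainLaw α r₀ r₁ ν)) (ha₁ : 0 < a₁)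
    (hν : ∀ᵐ F : Closeds Plane ∂ν, Metric.ball 0 a₁ ⊆ (F : Set Plane) ∧
      (F : Set Plane) ⊆ Metric.closedBall 0 a₂)
    (hα : 1 < α) (h0 : 0 < r₀) (h01 : (r₀ : EReal) < r₁) (h : r₁ ≠ ⊤ ∨ 3 < α) (x : Plane) :
    M.sameVisibleProb x * ∫ r in radiusRange r₀ r₁,
        r ^ (2 - α) * (2 * meanOverlap ν 0 - meanOverlap ν (r⁻¹ • x)) ≤
      ∫ r in radiusRange r₀ r₁, r ^ (2 - α) * meanOverlap ν (r⁻¹ • x) := by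
  obtain ⟨z, hz, hf, hpos, hE, hB⟩ := exists_intensity_eq ha₁ hν hα h0 h01 h x
  have := hM.sameVisibleProb_mul_le x hf hpos
  rw [hE, hB, mul_left_comm] at this
  exact le_of_mul_le_mul_left this hz

lemma integral_le_sameVisibleProb_mul {r₁ : ℝ} (hM : M.IsDeadLeaves (grainLaw α r₀ r₁ ν))
    (ha₁ : 0 < a₁)
    (hν : ∀ᵐ F : Closeds Plane ∂ν, Metric.ball 0 a₁ ⊆ (F : Set Plane) ∧
      (F : Set Plane) ⊆ Metric.closedBall 0 a₂)
    (hnull : ∀ᵐ F : Closeds Plane ∂ν, volume (frontier (F : Set Plane)) = 0)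
    (hα : 1 < α) (h0 : 0 < r₀) (h01 : r₀ < r₁) (x : Plane) :
    ∫ r in Icc r₀ r₁, r ^ (2 - α) * meanOverlap ν (r⁻¹ • x) ≤
      M.sameVisibleProb x * ∫ r in Icc r₀ r₁,
        r ^ (2 - α) * (2 * meanOverlap ν 0 - meanOverlap ν (r⁻¹ • x)) := by
  obtain ⟨z, hz, hf, hpos, hE, hB⟩ := exists_intensity_eq (r₁ := r₁) ha₁ hν hα h0
    (by exact_mod_cast h01) (Or.inl (EReal.coe_ne_top _)) x
  have := hM.le_sameVisibleProb_mul x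
    (ae_grainLaw_subset_closedBall h0 (hν.mono fun _ h => h.2))
    (ae_grainLaw_frontier_null h0 hnull) hf hpos
  rw [hE, hB, mul_left_comm, radiusRange_coe] at this
  exact le_of_mul_le_mul_left this hz

end LeafSequence.IsDeadLeaves

end Ratio

/-! ### Asymptotics of the integrals over the scaling factor -/

section Asymptotics

variable {φ : ℝ → ℝ} {V : ℝ}

lemma intervalIntegrable_rpow_of_pos {a b β : ℝ} (ha : 0 < a) (hb : 0 < b) :
    IntervalIntegrable (fun r : ℝ => r ^ β) volume a b :=
  intervalIntegral.intervalIntegrable_rpow (Or.inr fun h => by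
    have := h.1
    rw [inf_le_iff] at this
    rcases this with h | h <;> linarith)

/-- When `r ^ β` is integrable at `0` but not at infinity, the part of the integrals where `φ` is
close to its limit `V` dominates, uniformly in the lower bound `r₀`. -/
lemma eventually_mul_integral_le {β ε : ℝ} (hβ : -1 < β) (hV : 0 < V) (hφ : ∀ r, 0 ≤ φ r)
    (hint : ∀ a b, 0 < a → IntegrableOn (fun r => r ^ β * φ r) (Icc a b))
    (hlim : Tendsto φ atTop (𝓝 V)) (hε : 0 < ε) (hε1 : ε < 1) :
    ∀ᶠ r₁ in atTop, ∀ r₀ ∈ Ioo 0 r₁, (1 - ε) * ∫ r in Icc r₀ r₁, r ^ β * (2 * V - φ r) ≤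
      ∫ r in Icc r₀ r₁, r ^ β * φ r := by
  -- the claim is that the integral of `r ^ β * k r` is nonnegative
  set k : ℝ → ℝ := fun r => (2 - ε) * φ r - 2 * (1 - ε) * V
  have hk : Tendsto k atTop (𝓝 (ε * V)) := by
    have := (hlim.const_mul (2 - ε)).sub_const (2 * (1 - ε) * V)
    convert this using 2
    ring
  obtain ⟨A, hA0, hA⟩ : ∃ A : ℝ, 0 < A ∧ ∀ r ≥ A, ε * V / 2 ≤ k r := by
    obtain ⟨A, hA⟩ := eventually_atTop.1
      (hk.eventually (lt_mem_nhds (show ε * V / 2 < ε * V by nlinarith [mul_pos hε hV])))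
    exact ⟨max A 1, by positivity, fun r hr => (hA r ((le_max_left _ _).trans hr)).le⟩
  have hk0 : ∀ r, -(2 * V) ≤ k r := fun r => by
    have := mul_nonneg (show 0 ≤ 2 - ε by linarith) (hφ r)
    have := mul_pos hε hV
    simp only [k]
    linarith
  have hgrow : Tendsto (fun r₁ : ℝ => ε * V / 2 * ((r₁ ^ (β + 1) - A ^ (β + 1)) / (β + 1)))
      atTop atTop := by
    refine Tendsto.const_mul_atTop (by positivity) (Tendsto.atTop_div_const (by linarith) ?_)
    exact tendsto_atTop_add_const_right _ _ (tendsto_rpow_atTop (by linarith))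
  filter_upwards [hgrow.eventually_ge_atTop (2 * V * (A ^ (β + 1) / (β + 1))),
    eventually_ge_atTop A] with r₁ hr₁ hAr₁ r₀ hr₀
  have hw : IntegrableOn (fun r : ℝ => r ^ β) (Icc r₀ r₁) :=
    (intervalIntegrable_iff_integrableOn_Icc_of_le hr₀.2.le).1
      (intervalIntegrable_rpow_of_pos hr₀.1 (hr₀.1.trans hr₀.2))
  have hf := hint r₀ r₁ hr₀.1
  have hg : IntegrableOn (fun r : ℝ => r ^ β * (2 * V - φ r)) (Icc r₀ r₁) := by
    simp only [mul_sub]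
    exact (hw.mul_const _).sub hf
  have hki : ∀ a b, 0 < a → IntegrableOn (fun r : ℝ => r ^ β * k r) (Icc a b) := by
    intro a b ha
    rcases le_or_gt a b with hab | hab
    · have h1 : IntegrableOn (fun r : ℝ => r ^ β) (Icc a b) :=
        (intervalIntegrable_iff_integrableOn_Icc_of_le hab).1
          (intervalIntegrable_rpow_of_pos ha (ha.trans_le hab))
      have h2 : (fun r : ℝ => r ^ β * k r) =
          fun r => (2 - ε) * (r ^ β * φ r) - r ^ β * (2 * (1 - ε) * V) := by
        funext r; simp only [k]; ring
      rw [h2]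
      exact ((hint a b ha).const_mul _).sub (h1.mul_const _)
    · simp [Icc_eq_empty (not_le.2 hab)]
  suffices h : 0 ≤ ∫ r in Icc r₀ r₁, r ^ β * k r by
    have e : ∫ r in Icc r₀ r₁, r ^ β * k r = (∫ r in Icc r₀ r₁, r ^ β * φ r) -
        (1 - ε) * ∫ r in Icc r₀ r₁, r ^ β * (2 * V - φ r) := by
      rw [← integral_const_mul, ← integral_sub hf (hg.const_mul _)]
      congr 1
      funext r
      simp only [k]
      ring
    linarith
  have hlow : ∀ a, 0 < a → A ≤ a → ∀ r ∈ Icc a r₁, r ^ β * (ε * V / 2) ≤ r ^ β * k r :=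
    fun a ha hAa r hr => mul_le_mul_of_nonneg_left (hA r (hAa.trans hr.1))
      (Real.rpow_nonneg (ha.le.trans hr.1) _)
  rcases le_or_gt A r₀ with hAr₀ | hAr₀
  · refine setIntegral_nonneg measurableSet_Icc fun r hr => le_trans ?_ (hlow r₀ hr₀.1 hAr₀ r hr)
    have := Real.rpow_nonneg (hr₀.1.le.trans hr.1) β
    positivity
  · have hI : ∀ a b, 0 < a → a ≤ b → IntervalIntegrable (fun r : ℝ => r ^ β * k r) volume a b :=
      fun a b ha hab => (intervalIntegrable_iff_integrableOn_Icc_of_le hab).2 (hki a b ha)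
    rw [integral_Icc_eq_integral_Ioc, ← intervalIntegral.integral_of_le hr₀.2.le,
      ← intervalIntegral.integral_add_adjacent_intervals (hI r₀ A hr₀.1 hAr₀.le) (hI A r₁ hA0 hAr₁)]
    have h1 : ∫ r in r₀..A, r ^ β * -(2 * V) ≤ ∫ r in r₀..A, r ^ β * k r := by
      refine intervalIntegral.integral_mono_on hAr₀.le
        ((intervalIntegrable_rpow_of_pos hr₀.1 hA0).mul_const _) (hI r₀ A hr₀.1 hAr₀.le) ?_
      exact fun r hr => mul_le_mul_of_nonneg_left (hk0 r) (Real.rpow_nonneg (hr₀.1.le.trans hr.1) _)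
    have h2 : ∫ r in A..r₁, r ^ β * (ε * V / 2) ≤ ∫ r in A..r₁, r ^ β * k r :=
      intervalIntegral.integral_mono_on hAr₁
        ((intervalIntegrable_rpow_of_pos hA0 (hA0.trans_le hAr₁)).mul_const _) (hI A r₁ hA0 hAr₁)
        (hlow A hA0 le_rfl)
    rw [intervalIntegral.integral_mul_const, integral_rpow (Or.inl hβ)] at h1 h2
    have h3 : 0 ≤ 2 * V * (r₀ ^ (β + 1) / (β + 1)) := by
      have := Real.rpow_nonneg hr₀.1.le (β + 1)
      have : 0 < β + 1 := by linarith
      positivity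
    have h4 : (A ^ (β + 1) - r₀ ^ (β + 1)) / (β + 1) * -(2 * V) =
      2 * V * (r₀ ^ (β + 1) / (β + 1)) - 2 * V * (A ^ (β + 1) / (β + 1)) := by ring
    rw [h4] at h1
    linarith

lemma integral_inv_mul_eq_log {a b : ℝ} (ha : 0 < a) (hb : 0 < b) (c : ℝ) :
    ∫ r in a..b, r ^ (-1 : ℝ) * c = (Real.log b - Real.log a) * c := by
  rw [intervalIntegral.integral_mul_const, ← Real.log_div hb.ne' ha.ne', ← integral_inv_of_pos ha hb]
  congr 1
  exact intervalIntegral.integral_congr fun r _ => Real.rpow_neg_one r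

/-- The logarithmic mean of a function that tends to `V` tends to `V`. -/
lemma tendsto_integral_div_log {A : ℝ} (hA : 0 < A) (hφ : ∀ r, 0 ≤ φ r) (hφV : ∀ r, φ r ≤ V)
    (hint : ∀ a b, 0 < a → IntegrableOn (fun r => r ^ (-1 : ℝ) * φ r) (Icc a b))
    (hlim : Tendsto φ atTop (𝓝 V)) :
    Tendsto (fun b => (∫ r in A..b, r ^ (-1 : ℝ) * φ r) / Real.log b) atTop (𝓝 V) := by
  have hI : ∀ a b, 0 < a → a ≤ b →
      IntervalIntegrable (fun r : ℝ => r ^ (-1 : ℝ) * φ r) volume a b :=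
    fun a b ha hab => (intervalIntegrable_iff_integrableOn_Icc_of_le hab).2 (hint a b ha)
  have hbound : ∀ c B : ℝ, Tendsto (fun b => (Real.log b - Real.log B) * c / Real.log b) atTop
      (𝓝 c) := by
    intro c B
    have h1 : Tendsto (fun b => c - Real.log B * c / Real.log b) atTop (𝓝 (c - 0)) :=
      tendsto_const_nhds.sub (Real.tendsto_log_atTop.const_div_atTop _)
    rw [sub_zero] at h1
    refine h1.congr' ?_
    filter_upwards [eventually_gt_atTop 1] with b hb
    have := (Real.log_pos hb).ne'
    field_simp
  refine tendsto_order.2 ⟨fun c hc => ?_, fun c hc => ?_⟩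
  · obtain ⟨c', hcc', hc'V⟩ := exists_between hc
    obtain ⟨B, hB⟩ := eventually_atTop.1 (hlim.eventually (lt_mem_nhds hc'V))
    set B' := max A B
    have hB'0 : 0 < B' := hA.trans_le (le_max_left _ _)
    filter_upwards [(hbound c' B').eventually (lt_mem_nhds hcc'), eventually_gt_atTop 1,
      eventually_ge_atTop B'] with b h1 hb1 hbB
    refine h1.trans_le (div_le_div_of_nonneg_right ?_ (Real.log_pos hb1).le)
    rw [← integral_inv_mul_eq_log hB'0 (hB'0.trans_le hbB),
      ← intervalIntegral.integral_add_adjacent_intervals (hI A B' hA (le_max_left _ _))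
        (hI B' b hB'0 hbB)]
    have h2 : 0 ≤ ∫ r in A..B', r ^ (-1 : ℝ) * φ r :=
      intervalIntegral.integral_nonneg (le_max_left _ _) fun r hr =>
        mul_nonneg (Real.rpow_nonneg (hA.le.trans hr.1) _) (hφ r)
    have h3 : ∫ r in B'..b, r ^ (-1 : ℝ) * c' ≤ ∫ r in B'..b, r ^ (-1 : ℝ) * φ r :=
      intervalIntegral.integral_mono_on hbB
        ((intervalIntegrable_rpow_of_pos hB'0 (hB'0.trans_le hbB)).mul_const _) (hI B' b hB'0 hbB)
        fun r hr => mul_le_mul_of_nonneg_left (hB r ((le_max_right _ _).trans hr.1)).le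
          (Real.rpow_nonneg (hB'0.le.trans hr.1) _)
    linarith
  · filter_upwards [(hbound V A).eventually (gt_mem_nhds hc), eventually_gt_atTop 1,
      eventually_ge_atTop A] with b h1 hb1 hbA
    refine lt_of_le_of_lt (div_le_div_of_nonneg_right ?_ (Real.log_pos hb1).le) h1
    rw [← integral_inv_mul_eq_log hA (hA.trans_le hbA)]
    exact intervalIntegral.integral_mono_on hbA (hI A b hA hbA)
      ((intervalIntegrable_rpow_of_pos hA (hA.trans_le hbA)).mul_const _)
      fun r hr => mul_le_mul_of_nonneg_left (hφV r) (Real.rpow_nonneg (hA.le.trans hr.1) _)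

/-- When `r ^ β` is integrable at infinity but not at `0`, and `φ` vanishes near `0`, the integral
of `r ^ β * φ r` is negligible, uniformly in the upper bound `r₁`. -/
lemma eventually_integral_le_mul {β ε A : ℝ} (hβ : β < -1) (hA : 0 < A) (hV : 0 < V)
    (hφV : ∀ r, φ r ≤ V) (hφ0 : ∀ r, 0 < r → r < A → φ r = 0)
    (hint : ∀ (a : ℝ) (b : EReal), 0 < a → IntegrableOn (fun r => r ^ β * φ r) (radiusRange a b))
    (hε : 0 < ε) :
    ∀ᶠ r₀ : ℝ in 𝓝[>] 0, ∀ r₁ : EReal, (r₀ : EReal) < r₁ →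
      ∫ r in radiusRange r₀ r₁, r ^ β * φ r ≤
        ε * ∫ r in radiusRange r₀ r₁, r ^ β * (2 * V - φ r) := by
  set K := ∫ r in Ici A, r ^ β * V
  have hwA : IntegrableOn (fun r : ℝ => r ^ β * V) (Ici A) :=
    ((integrableOn_Ici_iff_integrableOn_Ioi (by simp)).2
      (integrableOn_Ioi_rpow_of_lt hβ hA)).mul_const _
  have hgrow : Tendsto (fun r₀ : ℝ => ε * (V * ((r₀ ^ (β + 1) - A ^ (β + 1)) / (-(β + 1)))))
      (𝓝[>] 0) atTop := by
    refine Tendsto.const_mul_atTop hε (Tendsto.const_mul_atTop hV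
      (Tendsto.atTop_div_const (by linarith) ?_))
    exact tendsto_atTop_add_const_right _ _ (tendsto_rpow_neg_nhdsGT_zero (by linarith))
  filter_upwards [hgrow.eventually_ge_atTop K, self_mem_nhdsWithin,
    mem_nhdsWithin_of_mem_nhds (gt_mem_nhds hA)] with r₀ hK hr₀ hr₀A r₁ _
  have hr₀' : (0 : ℝ) < r₀ := hr₀
  have hD := measurableSet_radiusRange r₀ r₁
  have hDpos : ∀ r ∈ radiusRange r₀ r₁, 0 < r := fun r hr => hr₀'.trans_le hr.1
  have hwi : IntegrableOn (fun r : ℝ => r ^ β) (radiusRange r₀ r₁) :=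
    integrableOn_rpow_radiusRange hr₀' (Or.inr hβ)
  have hgi : IntegrableOn (fun r : ℝ => r ^ β * (2 * V - φ r)) (radiusRange r₀ r₁) := by
    simp only [mul_sub]
    exact (hwi.mul_const _).sub (hint r₀ r₁ hr₀')
  have hgV : ∀ r ∈ radiusRange r₀ r₁, r ^ β * V ≤ r ^ β * (2 * V - φ r) := fun r hr =>
    mul_le_mul_of_nonneg_left (by linarith [hφV r]) (Real.rpow_nonneg (hDpos r hr).le _)
  have hg0 : ∀ r ∈ radiusRange r₀ r₁, 0 ≤ r ^ β * (2 * V - φ r) := fun r hr =>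
    (mul_nonneg (Real.rpow_nonneg (hDpos r hr).le _) hV.le).trans (hgV r hr)
  rcases lt_or_ge r₁ A with h | h
  · -- all the radii are so small that no grain contains both points
    have h0 : ∫ r in radiusRange r₀ r₁, r ^ β * φ r = 0 := by
      refine setIntegral_eq_zero_of_forall_eq_zero fun r hr => ?_
      rw [hφ0 r (hDpos r hr) (by exact_mod_cast hr.2.trans_lt h), mul_zero]
    rw [h0]
    exact mul_nonneg hε.le (setIntegral_nonneg hD hg0)
  · have h1 : ∫ r in radiusRange r₀ r₁, r ^ β * φ r ≤ K := by
      simp only [K]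
      rw [← integral_indicator hD, ← integral_indicator measurableSet_Ici]
      refine integral_mono ((integrable_indicator_iff hD).2 (hint r₀ r₁ hr₀'))
        ((integrable_indicator_iff measurableSet_Ici).2 hwA) fun r => ?_
      by_cases hr : r ∈ radiusRange r₀ r₁
      · rw [indicator_of_mem hr]
        rcases lt_or_ge r A with hrA | hrA
        · rw [hφ0 r (hDpos r hr) hrA, mul_zero, indicator_of_notMem (by simpa using hrA)]
        · rw [indicator_of_mem (mem_Ici.2 hrA)]
          exact mul_le_mul_of_nonneg_left (hφV r) (Real.rpow_nonneg (hDpos r hr).le _)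
      · rw [indicator_of_notMem hr]
        exact indicator_nonneg (fun s hs => mul_nonneg
          (Real.rpow_nonneg (hA.le.trans hs) _) hV.le) r
    have hsub : Icc r₀ A ⊆ radiusRange r₀ r₁ := fun r hr =>
      ⟨hr.1, (EReal.coe_le_coe_iff.2 hr.2).trans h⟩
    have h2 : V * ((r₀ ^ (β + 1) - A ^ (β + 1)) / (-(β + 1))) ≤
        ∫ r in radiusRange r₀ r₁, r ^ β * (2 * V - φ r) := by
      calc V * ((r₀ ^ (β + 1) - A ^ (β + 1)) / (-(β + 1))) = ∫ r in Icc r₀ A, r ^ β * V := by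
            rw [integral_Icc_eq_integral_Ioc, ← intervalIntegral.integral_of_le hr₀A.le,
              intervalIntegral.integral_mul_const, integral_rpow (Or.inr ⟨hβ.ne, fun h => by
                have := h.1
                rw [inf_le_iff] at this
                rcases this with h | h <;> linarith⟩), div_neg, ← neg_div, neg_sub, mul_comm]
        _ ≤ ∫ r in Icc r₀ A, r ^ β * (2 * V - φ r) :=
            setIntegral_mono_on ((hwi.mono_set hsub).mul_const _) (hgi.mono_set hsub)
              measurableSet_Icc fun r hr => hgV r (hsub hr)
        _ ≤ _ := setIntegral_mono_set hgi ((ae_restrict_mem hD).mono hg0) hsub.eventuallyLE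
    exact h1.trans (hK.trans (mul_le_mul_of_nonneg_left h2 hε.le))

end Asymptotics

/-! ### The three regimes -/

lemma LeafSequence.sameVisibleProb_nonneg (M : LeafSequence.{u}) (x : Plane) :
    0 ≤ M.sameVisibleProb x := measureReal_nonneg

lemma LeafSequence.sameVisibleProb_le_one (M : LeafSequence.{u}) (x : Plane) :
    M.sameVisibleProb x ≤ 1 := measureReal_le_one

theorem mainTheorem6 {Ω₀ : Type*} [MeasurableSpace Ω₀] (P₀ : Measure Ω₀) [IsProbabilityMeasure P₀]
    (Y : Ω₀ → Closeds Plane) (hY : Measurable Y)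
    (a₁ a₂ : ℝ) (ha₁ : 0 < a₁) (ha₁₂ : a₁ < a₂)
    (hYa : ∀ᵐ ω ∂P₀, Metric.closedBall (0 : Plane) a₁ ⊆ (Y ω : Set Plane) ∧
      (Y ω : Set Plane) ⊆ Metric.closedBall (0 : Plane) a₂)
    (α : ℝ) (hα : 1 < α)
    (M : ℝ → EReal → LeafSequence.{u})
    (hM : ∀ (r₀ : ℝ) (r₁ : EReal), 0 < r₀ → (r₀ : EReal) < r₁ → (r₁ ≠ ⊤ ∨ 3 < α) →
      (M r₀ r₁).IsDeadLeaves (grainLaw α r₀ r₁ (P₀.map Y)))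
    (x : Plane) (hx : x ≠ 0) :
    (α < 3 → (∀ᵐ ω ∂P₀, volume (frontier (Y ω : Set Plane)) = 0) →
      Tendsto (fun r₁ : ℝ => ⨅ r₀ : Ioo (0 : ℝ) r₁, (M r₀ r₁).sameVisibleProb x)
        atTop (𝓝 1)) ∧
    (3 < α →
      Tendsto (fun r₀ : ℝ => ⨆ r₁ : Ioi (r₀ : EReal), (M r₀ r₁).sameVisibleProb x)
        (𝓝[>] 0) (𝓝 0)) ∧
    (α = 3 → (∀ᵐ ω ∂P₀, volume (frontier (Y ω : Set Plane)) = 0) →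
      Tendsto (fun r : ℝ × ℝ => (M r.1 r.2).sameVisibleProb x *
        (1 - 2 * (Real.log r.1 / Real.log r.2))) (𝓝[>] 0 ×ˢ atTop) (𝓝 1)) := by
  set ν := P₀.map Y
  have : IsProbabilityMeasure ν := Measure.isProbabilityMeasure_map hY.aemeasurable
  have hν : ∀ᵐ F : Closeds Plane ∂ν, Metric.ball 0 a₁ ⊆ (F : Set Plane) ∧
      (F : Set Plane) ⊆ Metric.closedBall 0 a₂ := by
    have hm : MeasurableSet {F : Closeds Plane | Metric.ball 0 a₁ ⊆ (F : Set Plane) ∧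
        (F : Set Plane) ⊆ Metric.closedBall 0 a₂} :=
      (measurableSet_closeds_superset Metric.isOpen_ball).inter
        (measurableSet_closeds_subset_closedBall a₂)
    rw [ae_map_iff hY.aemeasurable hm]
    exact hYa.mono fun ω h => ⟨Metric.ball_subset_closedBall.trans h.1, h.2⟩
  have hν₂ := hν.mono fun _ h => h.2
  have hnull : (∀ᵐ ω ∂P₀, volume (frontier (Y ω : Set Plane)) = 0) →
      ∀ᵐ F : Closeds Plane ∂ν, volume (frontier (F : Set Plane)) = 0 :=
    (ae_map_iff hY.aemeasurable measurableSet_closeds_frontier_null).2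
  set φ : ℝ → ℝ := fun r => meanOverlap ν (r⁻¹ • x)
  set V := meanOverlap ν 0
  have hV : 0 < V := meanOverlap_zero_pos ha₁ hν
  have hφ : ∀ r, 0 ≤ φ r := fun r => meanOverlap_nonneg _ _
  have hφV : ∀ r, φ r ≤ V := fun r => meanOverlap_le hν₂ _
  have hlim : Tendsto φ atTop (𝓝 V) := by
    refine (tendsto_meanOverlap hν₂).comp ?_
    have := (tendsto_inv_atTop_zero (𝕜 := ℝ)).smul_const x
    rwa [zero_smul] at this
  -- a grain `r • Y` with `r < A` is too small to contain two points at the distance `‖x‖`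
  set A := ‖x‖ / (2 * a₂)
  have ha₂ : 0 < a₂ := ha₁.trans ha₁₂
  have hA : 0 < A := div_pos (norm_pos_iff.2 hx) (by linarith)
  have hφ0 : ∀ r, 0 < r → r < A → φ r = 0 := by
    intro r hr hrA
    refine meanOverlap_eq_zero hν₂ ?_
    rw [lt_div_iff₀ (by linarith)] at hrA
    rw [norm_smul, norm_inv, Real.norm_of_nonneg hr.le, inv_mul_eq_div, lt_div_iff₀ hr]
    linarith
  have hint : ∀ a b : ℝ, 0 < a → IntegrableOn (fun r => r ^ (2 - α) * φ r) (Icc a b) := by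
    intro a b ha
    rw [← radiusRange_coe]
    exact integrableOn_rpow_mul_meanOverlap hν₂ ha (Or.inl (EReal.coe_ne_top b)) x
  have hintE : (3 < α) → ∀ (a : ℝ) (b : EReal), 0 < a →
      IntegrableOn (fun r => r ^ (2 - α) * φ r) (radiusRange a b) := fun h3 a b ha =>
    integrableOn_rpow_mul_meanOverlap hν₂ ha (Or.inr h3) x
  -- the intensity of the leaves that hit `0` or `x` is positive
  have hGpos : ∀ (r₀ : ℝ) (r₁ : EReal), 0 < r₀ → (r₀ : EReal) < r₁ → (r₁ ≠ ⊤ ∨ 3 < α) →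
      0 < ∫ r in radiusRange r₀ r₁, r ^ (2 - α) * (2 * V - φ r) := by
    intro r₀ r₁ h0 h01 h
    refine setIntegral_radiusRange_pos h0 h01
      (fun r hr => mul_pos (Real.rpow_pos_of_pos hr _) (by linarith [hφV r])) ?_
    simp only [mul_sub]
    exact ((integrableOn_rpow_radiusRange h0 (h.imp_right fun h => by linarith)).mul_const _).sub
      (integrableOn_rpow_mul_meanOverlap hν₂ h0 h x)
  refine ⟨fun h3 hfr => ?_, fun h3 => ?_, fun h3 hfr => ?_⟩
  · refine tendsto_order.2 ⟨fun c hc => ?_, fun c hc => ?_⟩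
    · obtain ⟨ε, hε, hεc⟩ : ∃ ε, 0 < ε ∧ ε < min (1 - c) 1 :=
        exists_between (lt_min (by linarith) one_pos)
      have hev := eventually_mul_integral_le (β := 2 - α) (by linarith) hV hφ hint hlim hε
        (hεc.trans_le (min_le_right _ _))
      filter_upwards [hev, eventually_gt_atTop 0] with r₁ hr₁ hr₁0
      have : Nonempty (Ioo (0 : ℝ) r₁) := ⟨⟨r₁ / 2, by constructor <;> linarith⟩⟩
      refine lt_of_lt_of_le (b := 1 - ε) ?_ (le_ciInf fun r₀ => ?_)
      · have := hεc.trans_le (min_le_left _ _)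
        linarith
      · have h0 := r₀.2.1
        have h01 : ((r₀ : ℝ) : EReal) < r₁ := by exact_mod_cast r₀.2.2
        have hle := ((hM r₀ r₁ h0 h01
          (Or.inl (EReal.coe_ne_top _)))).integral_le_sameVisibleProb_mul ha₁ hν (hnull hfr) hα h0
          r₀.2.2 x
        have hG := hGpos r₀ r₁ h0 h01 (Or.inl (EReal.coe_ne_top _))
        rw [radiusRange_coe] at hG
        exact le_of_mul_le_mul_right ((hr₁ r₀ r₀.2).trans hle) hG
    · filter_upwards [eventually_gt_atTop 0] with r₁ hr₁0
      have hbdd : BddBelow (range fun r₀ : Ioo (0 : ℝ) r₁ => (M r₀ r₁).sameVisibleProb x) :=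
        ⟨0, by rintro _ ⟨r, rfl⟩; exact LeafSequence.sameVisibleProb_nonneg _ _⟩
      exact ((ciInf_le hbdd ⟨r₁ / 2, by constructor <;> linarith⟩).trans
        (LeafSequence.sameVisibleProb_le_one _ _)).trans_lt hc
  · refine tendsto_order.2 ⟨fun c hc => ?_, fun c hc => ?_⟩
    · exact Eventually.of_forall fun r₀ => hc.trans_le
        (Real.iSup_nonneg fun r₁ => LeafSequence.sameVisibleProb_nonneg _ _)
    · have hev := eventually_integral_le_mul (β := 2 - α) (by linarith) hA hV hφV hφ0
        (hintE h3) (half_pos hc)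
      filter_upwards [hev, self_mem_nhdsWithin] with r₀ hr₀ h0
      have : Nonempty (Ioi (r₀ : EReal)) := ⟨⟨⊤, EReal.coe_lt_top r₀⟩⟩
      refine (ciSup_le fun r₁ => ?_).trans_lt (half_lt_self hc)
      have hle := (hM r₀ r₁ h0 r₁.2 (Or.inr h3)).sameVisibleProb_mul_integral_le ha₁ hν hα h0
        r₁.2 (Or.inr h3) x
      exact le_of_mul_le_mul_right (hle.trans (hr₀ r₁ r₁.2)) (hGpos r₀ r₁ h0 r₁.2 (Or.inr h3))
  · subst h3
    have hβ : (2 : ℝ) - 3 = -1 := by norm_num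
    simp only [hβ] at hint hGpos
    set Φ : ℝ → ℝ := fun b => ∫ r in A..b, r ^ (-1 : ℝ) * φ r
    have hu : Tendsto (fun r : ℝ × ℝ => Φ r.2 / Real.log r.2) (𝓝[>] 0 ×ˢ atTop) (𝓝 V) :=
      (tendsto_integral_div_log hA hφ hφV hint hlim).comp tendsto_snd
    -- with `u = Φ r₁ / log r₁` and `s = log r₁ / (log r₁ - 2 * log r₀)`, the quantity is
    -- `u / (V + (V - u) * s)`, and `s` is bounded
    set s : ℝ × ℝ → ℝ := fun r => Real.log r.2 / (Real.log r.2 - 2 * Real.log r.1)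
    have hev : ∀ᶠ r : ℝ × ℝ in 𝓝[>] 0 ×ˢ atTop,
        (0 < r.1 ∧ r.1 < A ∧ r.1 < 1) ∧ (A < r.2 ∧ 1 < r.2) := by
      have h0 : ∀ᶠ r : ℝ in 𝓝[>] 0, 0 < r ∧ r < A ∧ r < 1 := by
        filter_upwards [self_mem_nhdsWithin, mem_nhdsWithin_of_mem_nhds (gt_mem_nhds hA),
          mem_nhdsWithin_of_mem_nhds (gt_mem_nhds one_pos)] with r h1 h2 h3
        exact ⟨h1, h2, h3⟩
      exact h0.prod_mk ((eventually_gt_atTop A).and (eventually_gt_atTop 1))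
    have hs : Tendsto (fun r => (V - Φ r.2 / Real.log r.2) * s r) (𝓝[>] 0 ×ˢ atTop) (𝓝 0) := by
      refine squeeze_zero_norm' (a := fun r => |V - Φ r.2 / Real.log r.2|) ?_ ?_
      · filter_upwards [hev] with r hr
        have h1 := Real.log_pos hr.2.2
        have h2 := Real.log_neg hr.1.1 hr.1.2.2
        have h3 : 0 ≤ s r := div_nonneg h1.le (by linarith)
        have h4 : s r ≤ 1 := div_le_one_of_le₀ (by linarith) (by linarith)
        rw [Real.norm_eq_abs, abs_mul, abs_of_nonneg h3]
        exact mul_le_of_le_one_right (abs_nonneg _) h4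
      · have := (hu.const_sub V).abs
        rwa [sub_self, abs_zero] at this
    have hmain := hu.div (hs.const_add V) (by rw [add_zero]; exact hV.ne')
    rw [add_zero, div_self hV.ne'] at hmain
    refine hmain.congr' ?_
    filter_upwards [hev] with r hr
    obtain ⟨r₀, r₁⟩ := r
    obtain ⟨⟨h0, h0A, h01⟩, hA1, h11⟩ := hr
    dsimp only at h0 h0A h01 hA1 h11 ⊢
    have hlt : r₀ < r₁ := h0A.trans hA1
    have hltE : (r₀ : EReal) < r₁ := by exact_mod_cast hlt
    have hml := (hM r₀ r₁ h0 hltE (Or.inl (EReal.coe_ne_top _)))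
    have hle := hml.sameVisibleProb_mul_integral_le ha₁ hν hα h0 hltE
      (Or.inl (EReal.coe_ne_top _)) x
    have hge := hml.integral_le_sameVisibleProb_mul ha₁ hν (hnull hfr) hα h0 hlt x
    have hG := hGpos r₀ r₁ h0 hltE (Or.inl (EReal.coe_ne_top _))
    rw [radiusRange_coe] at hle hG
    have heq := le_antisymm hle hge
    simp only [hβ] at heq
    have hI : ∀ a b, 0 < a → a ≤ b →
        IntervalIntegrable (fun r : ℝ => r ^ (-1 : ℝ) * φ r) volume a b :=
      fun a b ha hab => (intervalIntegrable_iff_integrableOn_Icc_of_le hab).2 (hint a b ha)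
    have hF : ∫ r in Icc r₀ r₁, r ^ (-1 : ℝ) * φ r = Φ r₁ := by
      rw [integral_Icc_eq_integral_Ioc, ← intervalIntegral.integral_of_le hlt.le,
        ← intervalIntegral.integral_add_adjacent_intervals (hI r₀ A h0 h0A.le) (hI A r₁ hA hA1.le),
        add_eq_right, intervalIntegral.integral_of_le h0A.le, integral_Ioc_eq_integral_Ioo]
      exact setIntegral_eq_zero_of_forall_eq_zero fun r hr => by
        rw [hφ0 r (h0.trans hr.1) hr.2, mul_zero]
    have hGe : ∫ r in Icc r₀ r₁, r ^ (-1 : ℝ) * (2 * V - φ r) =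
        (Real.log r₁ - Real.log r₀) * (2 * V) - Φ r₁ := by
      rw [← hF, ← integral_inv_mul_eq_log h0 (h0.trans hlt), intervalIntegral.integral_of_le hlt.le,
        ← integral_Icc_eq_integral_Ioc, ← integral_sub _ (hint r₀ r₁ h0)]
      · simp only [mul_sub]
      · exact ((intervalIntegrable_iff_integrableOn_Icc_of_le hlt.le).1
          (intervalIntegrable_rpow_of_pos h0 (h0.trans hlt))).mul_const _
    rw [hGe] at hG
    rw [show (∫ r in Icc r₀ r₁, r ^ (-1 : ℝ) * (2 * meanOverlap ν 0 - meanOverlap ν (r⁻¹ • x))) = _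
      from hGe, show (∫ r in Icc r₀ r₁, r ^ (-1 : ℝ) * meanOverlap ν (r⁻¹ • x)) = _ from hF] at heq
    have hl1 := Real.log_pos h11
    have hl0 := Real.log_neg h0 h01
    have hd : 0 < Real.log r₁ - 2 * Real.log r₀ := by linarith
    have hden : V + (V - Φ r₁ / Real.log r₁) * s (r₀, r₁) =
        ((Real.log r₁ - Real.log r₀) * (2 * V) - Φ r₁) / (Real.log r₁ - 2 * Real.log r₀) := by
      simp only [s]
      field_simp
      ring
    simp only [Pi.div_apply]
    rw [hden]
    generalize (Real.log r₁ - Real.log r₀) * (2 * V) - Φ r₁ = g at hG heq ⊢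
    rw [← heq]
    field_simp
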